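/- Let $F$ be an infinite field and let $\mathbb S(F,\mathbb N)=\langle F,\mathrm{List}(F),\mathbb N;\,t(s,a,i),\,\ell(s)\rangle$ be its list superstructure: the sorts are the field $F$, the set of nonempty finite lists over $F$, and the arithmetic $\mathbb N$; $t(s,a,i)$ says that $a$ is the $i$-th entry of $s$, and $\ell(s)$ is the length of $s$. Let $\mathcal M\equiv\mathbb S(F,\mathbb N)$ be elementarily equivalent to it, with number sort $\widetilde{\mathbb N}$. The ring $F[x](\mathcal M)$ of nonstandard polynomials consists of the elements of the list sort of $\mathcal M$, read as coefficient lists $(a_0,a_1,\dots)$ modulo tails of zeros, with coefficientwise addition and with the product $c_l=\sum_{i+j=l}a_ib_j$ (sums of nonstandard tuples are taken in $\mathcal M$, by means of tuples of partial sums). For $k\ge 1$, fix an enumeration $M_0,M_1,\dots$ of the monomials in $x_1,\dots,x_k$ that is first-order definable in $\mathbb S(F,\mathbb N)$ (for instance a recursive one); the ring $F[x_1,\dots,x_k](\mathcal M)$ is defined on the same set, with product $c_l=\sum_{M_iM_j=M_l}a_ib_j$, the relation $M_iM_j=M_l$ being interpreted in $\mathcal M$. A nonstandard tuple $P=(P_1,\dots,P_n)$,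 $n\in\widetilde{\mathbb N}$, $n\ge 1$, of nonstandard polynomials is one that is encoded by elements of $\mathcal M$ in the way in which finite tuples of polynomials are encoded in $\mathbb S(F,\mathbb N)$. Its nonstandard product $\prod P$ is the last entry of the nonstandard tuple $(S_1,\dots,S_n)$ with $S_1=P_1$ and $S_{i+1}=S_iP_{i+1}$. A nonstandard permutation of $[1,n]$ is a bijection of $[1,n]\subseteq\widetilde{\mathbb N}$ that is a nonstandard tuple of numbers, that is, a tuple encoded by a number under a first-order definable enumeration of the finite tuples of natural numbers. Let $R$ be $F[x](\mathcal M)$ or $F[x_1,\dots,x_k](\mathcal M)$ with $k\ge1$. Then $R$ is a well-defined commutative ring, and: 1. For every $q\in R$ that is neither zero nor a unit there are $n\in\widetilde{\mathbb N}$ and a nonstandard tuple $P=(P_1,\dots,P_n)$ of irreducible elements of $R$ with $q=\prod P$. 2. This factorization is unique up to a nonstandard permutation and units: if $P=(P_1,\dots,P_n)$ and $S=(S_1,\dots,S_m)$ are nonstandard tuples of irreducible elements of $R$ with $\prod P=\prod S$, then $n=m$, and there are a nonstandard permutation $\sigma$ of $[1,n]$ and a nonstandard tuple $A=(A_1,\dots,A_n)$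 of units of $R$ with $\prod A=1$ such that $P_i=A_iS_{\sigma(i)}$ for all $1\le i\le n$. -/

import Mathlib

open FirstOrder

universe u v

/-! ## The list superstructure of a field as a first-order structure

The three sorts (field, lists, numbers) are put into one universe and separated by unary
predicates; the operations are represented by the predicates that define their graphs. -/

/-- The constants `0`, `1` of the field sort and of the number sort. -/
inductive ListConst : ℕ → Type
  | zeroF : ListConst 0
  | oneF : ListConst 0
  | zeroN : ListConst 0
  | oneN : ListConst 0

/-- The sort predicates, the graphs of the operations of the field and of arithmetic, the
predicate `t(s, a, i)` ("`a` is the `i`-th entry of `s`") and the graph of the length function. -/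
inductive ListRel : ℕ → Type
  | isField : ListRel 1
  | isList : ListRel 1
  | isNum : ListRel 1
  | addF : ListRel 3
  | mulF : ListRel 3
  | addN : ListRel 3
  | mulN : ListRel 3
  | entry : ListRel 3
  | len : ListRel 2

/-- The language of list superstructures of fields. -/
def listLang : Language := ⟨ListConst, ListRel⟩

/-- The universe of `S(F, ℕ)`: elements of `F`, nonempty finite lists over `F`, and natural
numbers. -/
inductive ListSuper (F : Type u) : Type u
  | fld (a : F) : ListSuper F
  | lst (s : List F) (hs : s ≠ []) : ListSuper F
  | num (n : ℕ) : ListSuper F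

/-- The list superstructure `S(F, ℕ)`. List entries are counted from `1`. -/
instance ListSuper.instStructure (F : Type u) [Field F] : listLang.Structure (ListSuper F) where
  funMap := fun {_} c _ =>
    match c with
    | ListConst.zeroF => .fld 0
    | ListConst.oneF => .fld 1
    | ListConst.zeroN => .num 0
    | ListConst.oneN => .num 1
  RelMap := fun {_} r =>
    match r with
    | ListRel.isField => fun x => ∃ a, x 0 = .fld a
    | ListRel.isList => fun x => ∃ s hs, x 0 = .lst s hs
    | ListRel.isNum => fun x => ∃ n, x 0 = .num n
    | ListRel.addF => fun x => ∃ a b, x 0 = .fld a ∧ x 1 = .fld b ∧ x 2 = .fld (a + b)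
    | ListRel.mulF => fun x => ∃ a b, x 0 = .fld a ∧ x 1 = .fld b ∧ x 2 = .fld (a * b)
    | ListRel.addN => fun x => ∃ m n, x 0 = .num m ∧ x 1 = .num n ∧ x 2 = .num (m + n)
    | ListRel.mulN => fun x => ∃ m n, x 0 = .num m ∧ x 1 = .num n ∧ x 2 = .num (m * n)
    | ListRel.entry => fun x =>
        ∃ s hs a i, x 0 = .lst s hs ∧ x 1 = .fld a ∧ x 2 = .num (i + 1) ∧ s[i]? = some a
    | ListRel.len => fun x => ∃ s hs, x 0 = .lst s hs ∧ x 1 = .num s.length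

namespace NonstdPoly

/-! ## Vocabulary of an arbitrary structure in this language -/

section Vocabulary

variable (M : Type v) [listLang.Structure M]

/-- The field sort. -/
abbrev FieldSort : Type v :=
  {a : M // Language.Structure.RelMap (L := listLang) ListRel.isField ![a]}

/-- The list sort. -/
abbrev ListSort : Type v :=
  {s : M // Language.Structure.RelMap (L := listLang) ListRel.isList ![s]}

/-- The number sort. -/
abbrev NumSort : Type v :=
  {n : M // Language.Structure.RelMap (L := listLang) ListRel.isNum ![n]}

/-- The zero of the field sort. -/
def zeroF : M := Language.Structure.funMap (L := listLang) ListConst.zeroF ![]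

/-- The number `1`. -/
def oneN : M := Language.Structure.funMap (L := listLang) ListConst.oneN ![]

variable {M}

/-- `a + b = c` in the field sort. -/
def AddF (a b c : M) : Prop := Language.Structure.RelMap (L := listLang) ListRel.addF ![a, b, c]

/-- `a * b = c` in the field sort. -/
def MulF (a b c : M) : Prop := Language.Structure.RelMap (L := listLang) ListRel.mulF ![a, b, c]

/-- `m + n = k` in the number sort. -/
def AddN (m n k : M) : Prop := Language.Structure.RelMap (L := listLang) ListRel.addN ![m, n, k]

/-- `m * n = k` in the number sort. -/
def MulN (m n k : M) : Prop := Language.Structure.RelMap (L := listLang) ListRel.mulN ![m, n, k]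

/-- `t(s, a, i)`: the `i`-th entry of the list `s` is `a` (counted from `1`). -/
def Entry (s a i : M) : Prop := Language.Structure.RelMap (L := listLang) ListRel.entry ![s, a, i]

/-- The length of the list `s` is `n`. -/
def Len (s n : M) : Prop := Language.Structure.RelMap (L := listLang) ListRel.len ![s, n]

/-- `i ≤ j` in the number sort. -/
def Le (i j : M) : Prop := ∃ d : NumSort M, AddN i d j

/-- `i < j` in the number sort. -/
def Lt (i j : M) : Prop := ∃ i' : NumSort M, AddN i (oneN M) i' ∧ Le (i' : M) j

end Vocabulary

/-! ## Nonstandard polynomials -/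

section Polynomials

variable {M : Type v} [listLang.Structure M]

/-- `a` is the coefficient with index `j` of the polynomial with coefficient list `s`. Coefficients
are counted from `0`, so this is the entry of `s` at place `j + 1`; it is `0` when `s` has no such
entry. -/
def Coef (s : ListSort M) (j : NumSort M) (a : FieldSort M) : Prop :=
  (∃ i : NumSort M, AddN (j : M) (oneN M) i ∧ Entry (s : M) a i) ∨
    ((¬ ∃ (i : NumSort M) (b : FieldSort M), AddN (j : M) (oneN M) i ∧ Entry (s : M) b i) ∧
      (a : M) = zeroF M)

/-- Two coefficient lists differ only by a tail of zeros. -/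
def TailEq (s t : ListSort M) : Prop :=
  ∀ (j : NumSort M) (a : FieldSort M), Coef s j a ↔ Coef t j a

/-- The sum of the nonstandard tuple `d` of field elements is `c`: the tuple `r` of partial sums
`r₁ = d₁`, `rᵢ₊₁ = rᵢ + dᵢ₊₁` has last entry `c`. -/
def IsSum (d : ListSort M) (c : FieldSort M) : Prop :=
  ∃ (r : ListSort M) (n : NumSort M), Len (d : M) n ∧ Len (r : M) n ∧
    (∀ a : FieldSort M, Entry (r : M) a (oneN M) ↔ Entry (d : M) a (oneN M)) ∧
    (∀ (i i' : NumSort M) (x y z : FieldSort M), AddN (i : M) (oneN M) i' →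
      Entry (r : M) x i → Entry (d : M) y i' → Entry (r : M) z i' → AddF (x : M) y z) ∧
    Entry (r : M) c n

/-- Addition of coefficient lists: coefficientwise. -/
def ListAdd (a b c : ListSort M) : Prop :=
  ∀ j : NumSort M, ∃ x y z : FieldSort M, Coef a j x ∧ Coef b j y ∧ Coef c j z ∧ AddF (x : M) y z

/-- Multiplication of coefficient lists, when `mon i j l` says that the product of the monomials
with indices `i` and `j` is the monomial with index `l`. The coefficient of `c` at `l` is the sum of
all `aᵢ bⱼ` with `mon i j l`: the sum of the tuple `d`, of the same length as `a`, whose term at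
`i` is `aᵢ bⱼ` if there is such a `j`, and `0` otherwise. -/
def ListMul (mon : NumSort M → NumSort M → NumSort M → Prop) (a b c : ListSort M) : Prop :=
  ∀ l : NumSort M, ∃ (d : ListSort M) (n : NumSort M) (e : FieldSort M),
    Len (a : M) n ∧ Len (d : M) n ∧
    (∀ i : NumSort M, Lt (i : M) n → ∃ x : FieldSort M, Coef d i x ∧
      ((∃ (j : NumSort M) (y z : FieldSort M),
          mon i j l ∧ Coef a i y ∧ Coef b j z ∧ MulF (y : M) z x) ∨
        ((¬ ∃ j : NumSort M, mon i j l) ∧ (x : M) = zeroF M))) ∧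
    IsSum d e ∧ Coef c l e

variable (M) in
/-- The set of nonstandard polynomials over `M`: the elements of the list sort, as coefficient
lists, up to tails of zeros. -/
def NPoly : Type v := Quot (TailEq (M := M))

/-- The polynomial with a given coefficient list. -/
def NPoly.mk (s : ListSort M) : NPoly M := Quot.mk _ s

/-- The ring structure on the set of nonstandard polynomials is the one defined in `M` by the
formulas for addition and multiplication of coefficient lists. -/
def IsPolyRing (mon : NumSort M → NumSort M → NumSort M → Prop) [CommRing (NPoly M)] : Prop :=
  (∀ p q r : NPoly M, p + q = r ↔
    ∃ a b c : ListSort M, NPoly.mk a = p ∧ NPoly.mk b = q ∧ NPoly.mk c = r ∧ ListAdd a b c) ∧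
  (∀ p q r : NPoly M, p * q = r ↔
    ∃ a b c : ListSort M, NPoly.mk a = p ∧ NPoly.mk b = q ∧ NPoly.mk c = r ∧ ListMul mon a b c)

variable (M) in
/-- One variable: the index of a monomial is its exponent, `x ^ i * x ^ j = x ^ (i + j)`. -/
def monSingle (i j l : NumSort M) : Prop := AddN (i : M) j l

end Polynomials

/-- An enumeration `M₀, M₁, …` of the monomials in `k` variables (that is, of their exponent
vectors) which is given by a first-order formula. -/
structure MonomialEnum (F : Type u) [Field F] (k : ℕ) where
  /-- The enumeration in the standard model. -/
  monomial : ℕ ≃ (Fin k → ℕ)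
  /-- The formula that defines its graph. -/
  graph : listLang.Formula (Fin (k + 1))
  graph_spec : ∀ (n : ℕ) (e : Fin k → ℕ),
    graph.Realize (M := ListSuper F)
      (Fin.cons (ListSuper.num n) (fun t => ListSuper.num (e t))) ↔ monomial n = e

/-- `Mᵢ * Mⱼ = Mₗ` in a structure `M`: the exponent vectors that the enumerating formula assigns to
the indices add up. -/
def MonomialEnum.mon {F : Type u} [Field F] {k : ℕ} (E : MonomialEnum F k)
    (M : Type v) [listLang.Structure M] (i j l : NumSort M) : Prop :=
  ∃ e f g : Fin k → NumSort M,
    E.graph.Realize (M := M) (Fin.cons (i : M) (fun t => (e t : M))) ∧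
    E.graph.Realize (M := M) (Fin.cons (j : M) (fun t => (f t : M))) ∧
    E.graph.Realize (M := M) (Fin.cons (l : M) (fun t => (g t : M))) ∧
    ∀ t, AddN (e t : M) (f t) (g t)

/-- An enumeration of all nonempty finite tuples of natural numbers such that the relations
"the `i`-th entry of the `n`-th tuple is `a`" and "the length of the `n`-th tuple is `m`" are given
by first-order formulas. -/
structure TupleEnum (F : Type u) [Field F] where
  /-- The enumeration in the standard model. -/
  tuple : ℕ ≃ {s : List ℕ // s ≠ []}
  /-- The formula `T(n, a, i)`. -/
  T : listLang.Formula (Fin 3)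
  /-- The formula `L(n, m)`. -/
  L : listLang.Formula (Fin 2)
  T_spec : ∀ n a i : ℕ, T.Realize (M := ListSuper F) ![.num n, .num a, .num i] ↔
    1 ≤ i ∧ (tuple n).1[i - 1]? = some a
  L_spec : ∀ n m : ℕ, L.Realize (M := ListSuper F) ![.num n, .num m] ↔ (tuple n).1.length = m

/-! ## Nonstandard tuples, products and permutations -/

section Tuples

variable {M : Type v} [listLang.Structure M]

/-- The interval `[1, n]` of the number sort. -/
abbrev Idx (n : NumSort M) : Type v := {i : NumSort M // Le (oneN M) (i : M) ∧ Le (i : M) n}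

/-- `P = (P₁, …, Pₙ)` is a nonstandard tuple of nonstandard polynomials: there is a list `A` in `M`,
of length `n * m`, that consists of `n` successive blocks of length `m`, the `i`-th of which holds
the coefficients of `Pᵢ` (the coefficients of `Pᵢ` with index at least `m` being `0`).
For `S(F, ℕ)` these are exactly all finite nonempty tuples of polynomials. -/
def IsNonstdTuple {n : NumSort M} (P : Idx n → NPoly M) : Prop :=
  ∃ (A : ListSort M) (m N : NumSort M), MulN (n : M) m N ∧ Len (A : M) N ∧
    ∀ i : Idx n, ∃ s : ListSort M, NPoly.mk s = P i ∧
      ∀ (j : NumSort M) (a : FieldSort M),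
        (Lt (j : M) m → (Coef s j a ↔ ∃ i' b q : NumSort M,
          AddN (i' : M) (oneN M) i.1 ∧ MulN (i' : M) m b ∧ AddN (b : M) j q ∧ Coef A q a)) ∧
        (¬ Lt (j : M) m → (Coef s j a ↔ (a : M) = zeroF M))

/-- The nonstandard product of the tuple `P` is `q`: the nonstandard tuple `S` of partial products
`S₁ = P₁`, `Sᵢ₊₁ = Sᵢ * Pᵢ₊₁` has last entry `q`. -/
def IsNonstdProd [CommRing (NPoly M)] {n : NumSort M} (P : Idx n → NPoly M) (q : NPoly M) : Prop :=
  ∃ S : Idx n → NPoly M, IsNonstdTuple S ∧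
    (∀ i : Idx n, (i.1 : M) = oneN M → S i = P i) ∧
    (∀ i i' : Idx n, AddN (i.1 : M) (oneN M) i'.1 → S i' = S i * P i') ∧
    (∃ i : Idx n, i.1 = n ∧ S i = q)

/-- `P` is a factorization of `q` into a nonstandard tuple of irreducibles. -/
def IsNonstdFactorization [CommRing (NPoly M)] {n : NumSort M} (P : Idx n → NPoly M)
    (q : NPoly M) : Prop :=
  IsNonstdTuple P ∧ (∀ i, Irreducible (P i)) ∧ IsNonstdProd P q

/-- A map between intervals of numbers is a nonstandard tuple of numbers: it is the tuple with
some number `c` under the enumeration. -/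
def IsNonstdNumTuple {F : Type u} [Field F] (T : TupleEnum F) {n m : NumSort M}
    (σ : Idx n → Idx m) : Prop :=
  ∃ c : NumSort M, T.L.Realize (M := M) ![(c : M), (n : M)] ∧
    ∀ (i : Idx n) (a : NumSort M),
      T.T.Realize (M := M) ![(c : M), (a : M), (i.1 : M)] ↔ a = (σ i).1

/-- The tuples `P` and `S` have the same length `n`, and there are a nonstandard permutation `σ` of
`[1, n]` and a nonstandard tuple of units `A` with product `1` such that `Pᵢ = Aᵢ * S_{σ(i)}`. -/
def EqUpToPermAndUnits {F : Type u} [Field F] (T : TupleEnum F) [CommRing (NPoly M)]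
    {n m : NumSort M} (P : Idx n → NPoly M) (S : Idx m → NPoly M) : Prop :=
  n = m ∧ ∃ (σ : Idx n ≃ Idx m) (A : Idx n → NPoly M),
    IsNonstdNumTuple T σ ∧ IsNonstdTuple A ∧ (∀ i, IsUnit (A i)) ∧ IsNonstdProd A 1 ∧
    ∀ i, P i = A i * S (σ i)

end Tuples

end NonstdPoly

/-! Over `S(F, ℕ)` itself the theorem is classical. Coefficient lists modulo tails of zeros are
polynomials over `F`, so the ring is isomorphic to `MvPolynomial (Fin k) F` (with `k = 1` for
`monSingle`), a unique factorization domain. For `n ≥ 1` every function on `[1, n]` with values in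
this ring is a nonstandard tuple, every map between intervals is a tuple coded by a number, and the
nonstandard product is the ordinary finite product. This is carried by `Standard.exists_isPolyRing`,
`Standard.isNonstdTuple`, `Standard.isNonstdNumTuple` and `Standard.isNonstdProd_iff`.

Elementary equivalence then carries the result to `M`, provided that it is first-order. As stated it
is not, for three reasons: it speaks of classes of lists, of a ring structure, and of functions on
intervals. A class is replaced by any representative, with `TailEq` as equality. A ring structure is
replaced by axioms on the graphs of its operations (`isCommRingRel_iff`). A tuple is replaced by a
list cut into blocks, and a permutation by a number; `IsPolyRing.existsFactorizationRel_iff` and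
`IsPolyRing.uniqueFactorizationRel_iff` show that nothing is lost.

The formulas are never written down. `JDef` says that two predicates, one over each structure, are
defined by one common formula; its closure under connectives, quantifiers and substitution lets
instance search assemble the formula, and `JDef.transfer` concludes. -/

namespace NonstdPoly

/-! ## Simultaneous definability in two structures -/

section JointDefinability

/-- Simultaneous interpretation of a type `S` in `M` and of a type `S'` in `N`: their elements are
coded, by the same definable domain, by finite tuples of elements of the two structures. -/
class Interp (L : FirstOrder.Language.{0, 0}) (M : Type v) (N : Type u) [L.Structure M]
    [L.Structure N]
    (S : Type*) (S' : Type*) where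
  /-- The variables in which the codes are written. -/
  Var : Type
  finite : Finite Var
  /-- The tuples that code an element of `S`. -/
  code : (Var → M) → S → Prop
  /-- The tuples that code an element of `S'`. -/
  code' : (Var → N) → S' → Prop
  /-- The formula that defines the set of codes. -/
  dom : L.Formula Var
  dom_iff : ∀ v, dom.Realize v ↔ ∃ s, code v s
  dom_iff' : ∀ v, dom.Realize v ↔ ∃ s, code' v s
  surj : ∀ s, ∃ v, code v s
  surj' : ∀ s, ∃ v, code' v s

attribute [instance] Interp.finite

variable {L : FirstOrder.Language.{0, 0}} {M : Type v} {N : Type u} [L.Structure M] [L.Structure N]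
variable {S S' T T' U U' W W' X X' : Type*} [I : Interp L M N S S'] [J : Interp L M N T T']
  [K : Interp L M N U U'] [Interp L M N W W'] [Interp L M N X X']

instance Interp.unit : Interp L M N Unit Unit where
  Var := Empty
  finite := inferInstance
  code _ _ := True
  code' _ _ := True
  dom := ⊤
  dom_iff _ := by simp
  dom_iff' _ := by simp
  surj _ := ⟨Empty.elim, trivial⟩
  surj' _ := ⟨Empty.elim, trivial⟩

instance Interp.self : Interp L M N M N where
  Var := Unit
  finite := inferInstance
  code v s := v () = s
  code' v s := v () = s
  dom := ⊤
  dom_iff _ := by simp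
  dom_iff' _ := by simp
  surj s := ⟨fun _ => s, rfl⟩
  surj' s := ⟨fun _ => s, rfl⟩

instance Interp.prod : Interp L M N (S × T) (S' × T') where
  Var := I.Var ⊕ J.Var
  finite := inferInstance
  code v s := I.code (v ∘ Sum.inl) s.1 ∧ J.code (v ∘ Sum.inr) s.2
  code' v s := I.code' (v ∘ Sum.inl) s.1 ∧ J.code' (v ∘ Sum.inr) s.2
  dom := I.dom.relabel Sum.inl ⊓ J.dom.relabel Sum.inr
  dom_iff v := by simp [Interp.dom_iff]
  dom_iff' v := by simp [Interp.dom_iff']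
  surj s := by
    obtain ⟨v, hv⟩ := I.surj s.1
    obtain ⟨w, hw⟩ := J.surj s.2
    exact ⟨Sum.elim v w, by simpa using ⟨hv, hw⟩⟩
  surj' s := by
    obtain ⟨v, hv⟩ := I.surj' s.1
    obtain ⟨w, hw⟩ := J.surj' s.2
    exact ⟨Sum.elim v w, by simpa using ⟨hv, hw⟩⟩

/-- Tuples of a fixed standard length need only finitely many variables. This covers the quantifiers
over exponent vectors in `MonomialEnum.mon`. -/
noncomputable instance Interp.tuple {k : ℕ} : Interp L M N (Fin k → S) (Fin k → S') where
  Var := Fin k × I.Var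
  finite := inferInstance
  code v s := ∀ i, I.code (fun x => v (i, x)) (s i)
  code' v s := ∀ i, I.code' (fun x => v (i, x)) (s i)
  dom := Language.Formula.iInf fun i => I.dom.relabel fun x => (i, x)
  dom_iff v := by
    simp only [Language.Formula.realize_iInf, Language.Formula.realize_relabel, I.dom_iff]
    exact Classical.skolem
  dom_iff' v := by
    simp only [Language.Formula.realize_iInf, Language.Formula.realize_relabel, I.dom_iff']
    exact Classical.skolem
  surj s := by
    choose v hv using fun i => I.surj (s i)
    exact ⟨fun x => v x.1 x.2, hv⟩
  surj' s := by
    choose v hv using fun i => I.surj' (s i)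
    exact ⟨fun x => v x.1 x.2, hv⟩

variable (L M N)

/-- The predicates `P` and `P'` are defined by the same formula in `M` and in `N`. -/
class JDef (P : S → Prop) (P' : S' → Prop) : Prop where
  exists_formula : ∃ φ : L.Formula I.Var, (∀ v s, I.code v s → (φ.Realize v ↔ P s)) ∧
    ∀ v s, I.code' v s → (φ.Realize v ↔ P' s)

/-- The maps `f` and `f'` are given on codes by the same terms in `M` and in `N`. -/
class JMap (f : S → T) (f' : S' → T') : Prop where
  exists_term : ∃ τ : J.Var → L.Term I.Var,
    (∀ v s, I.code v s → J.code (fun x => (τ x).realize v) (f s)) ∧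
    ∀ v s, I.code' v s → J.code' (fun x => (τ x).realize v) (f' s)

variable {L M N}

/-- Substituting the terms for `f` into the formula for `P` gives one formula that works in both
structures. -/
theorem JDef.comp {P : T → Prop} {P' : T' → Prop} (h : JDef L M N P P') (f : S → T) (f' : S' → T')
    [hf : JMap L M N f f'] : JDef L M N (fun s => P (f s)) (fun s => P' (f' s)) := by
  obtain ⟨φ, h₁, h₂⟩ := h
  obtain ⟨τ, t₁, t₂⟩ := hf
  refine ⟨⟨φ.subst τ, fun v s hs => ?_, fun v s hs => ?_⟩⟩
  · rw [← h₁ _ _ (t₁ v s hs)]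
    exact Language.BoundedFormula.realize_subst
  · rw [← h₂ _ _ (t₂ v s hs)]
    exact Language.BoundedFormula.realize_subst

instance JMap.id : JMap L M N (fun s : S => s) (fun s : S' => s) :=
  ⟨⟨Language.Term.var, fun _ _ h => h, fun _ _ h => h⟩⟩

instance JMap.fst {f : S → T × U} {f' : S' → T' × U'} [h : JMap L M N f f'] :
    JMap L M N (fun s => (f s).1) (fun s => (f' s).1) := by
  obtain ⟨τ, h₁, h₂⟩ := h
  exact ⟨⟨fun x => τ (Sum.inl x), fun v s hs => (h₁ v s hs).1, fun v s hs => (h₂ v s hs).1⟩⟩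

instance JMap.snd {f : S → T × U} {f' : S' → T' × U'} [h : JMap L M N f f'] :
    JMap L M N (fun s => (f s).2) (fun s => (f' s).2) := by
  obtain ⟨τ, h₁, h₂⟩ := h
  exact ⟨⟨fun x => τ (Sum.inr x), fun v s hs => (h₁ v s hs).2, fun v s hs => (h₂ v s hs).2⟩⟩

theorem JMap.pair {f : S → T} {f' : S' → T'} {g : S → U} {g' : S' → U'} [h : JMap L M N f f']
    [k : JMap L M N g g'] : JMap L M N (fun s => (f s, g s)) (fun s => (f' s, g' s)) := by
  obtain ⟨τ, h₁, h₂⟩ := h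
  obtain ⟨σ, k₁, k₂⟩ := k
  exact ⟨⟨Sum.elim τ σ, fun v s hs => ⟨h₁ v s hs, k₁ v s hs⟩,
    fun v s hs => ⟨h₂ v s hs, k₂ v s hs⟩⟩⟩

theorem JDef.comp₂ {P : T × U → Prop} {P' : T' × U' → Prop} (h : JDef L M N P P') (f : S → T)
    (f' : S' → T') (g : S → U) (g' : S' → U') [JMap L M N f f'] [JMap L M N g g'] :
    JDef L M N (fun s => P (f s, g s)) (fun s => P' (f' s, g' s)) :=
  h.comp _ _ (hf := JMap.pair)

theorem JDef.comp₃ {P : T × U × W → Prop} {P' : T' × U' × W' → Prop} (h : JDef L M N P P')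
    (f : S → T) (f' : S' → T') (g : S → U) (g' : S' → U') (k : S → W) (k' : S' → W')
    [JMap L M N f f'] [JMap L M N g g'] [JMap L M N k k'] :
    JDef L M N (fun s => P (f s, g s, k s)) (fun s => P' (f' s, g' s, k' s)) :=
  h.comp _ _ (hf := JMap.pair (k := JMap.pair))

theorem JDef.comp₄ {P : T × U × W × X → Prop} {P' : T' × U' × W' × X' → Prop}
    (h : JDef L M N P P') (f : S → T) (f' : S' → T') (g : S → U) (g' : S' → U') (k : S → W)
    (k' : S' → W') (l : S → X) (l' : S' → X')
    [JMap L M N f f'] [JMap L M N g g'] [JMap L M N k k'] [JMap L M N l l'] :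
    JDef L M N (fun s => P (f s, g s, k s, l s)) (fun s => P' (f' s, g' s, k' s, l' s)) :=
  h.comp _ _ (hf := JMap.pair (k := JMap.pair (k := JMap.pair)))

instance JMap.apply {k : ℕ} {f : S → Fin k → T} {f' : S' → Fin k → T'} [h : JMap L M N f f']
    (i : Fin k) : JMap L M N (fun s => f s i) (fun s => f' s i) := by
  obtain ⟨τ, h₁, h₂⟩ := h
  exact ⟨⟨fun x => τ (i, x), fun v s hs => h₁ v s hs i, fun v s hs => h₂ v s hs i⟩⟩

theorem JMap.pi {k : ℕ} {f : S → Fin k → T} {f' : S' → Fin k → T'}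
    (h : ∀ i, JMap L M N (fun s => f s i) (fun s => f' s i)) : JMap L M N f f' := by
  choose τ h₁ h₂ using fun i => (h i).exists_term
  exact ⟨⟨fun x => τ x.1 x.2, fun v s hs i => h₁ i v s hs, fun v s hs i => h₂ i v s hs⟩⟩

instance JDef.true : JDef L M N (fun _ : S => True) (fun _ : S' => True) :=
  ⟨⟨⊤, by simp, by simp⟩⟩

variable {P Q : S → Prop} {P' Q' : S' → Prop}

instance JDef.not [h : JDef L M N P P'] : JDef L M N (fun s => ¬ P s) (fun s => ¬ P' s) := by
  obtain ⟨φ, h₁, h₂⟩ := h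
  exact ⟨⟨φ.not, fun v s hs => by rw [Language.Formula.realize_not, h₁ v s hs],
    fun v s hs => by rw [Language.Formula.realize_not, h₂ v s hs]⟩⟩

instance JDef.and [h : JDef L M N P P'] [k : JDef L M N Q Q'] :
    JDef L M N (fun s => P s ∧ Q s) (fun s => P' s ∧ Q' s) := by
  obtain ⟨φ, h₁, h₂⟩ := h
  obtain ⟨ψ, k₁, k₂⟩ := k
  exact ⟨⟨φ ⊓ ψ, fun v s hs => by rw [Language.Formula.realize_inf, h₁ v s hs, k₁ v s hs],
    fun v s hs => by rw [Language.Formula.realize_inf, h₂ v s hs, k₂ v s hs]⟩⟩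

instance JDef.or [h : JDef L M N P P'] [k : JDef L M N Q Q'] :
    JDef L M N (fun s => P s ∨ Q s) (fun s => P' s ∨ Q' s) := by
  obtain ⟨φ, h₁, h₂⟩ := h
  obtain ⟨ψ, k₁, k₂⟩ := k
  exact ⟨⟨φ ⊔ ψ, fun v s hs => by rw [Language.Formula.realize_sup, h₁ v s hs, k₁ v s hs],
    fun v s hs => by rw [Language.Formula.realize_sup, h₂ v s hs, k₂ v s hs]⟩⟩

instance JDef.imp [h : JDef L M N P P'] [k : JDef L M N Q Q'] :
    JDef L M N (fun s => P s → Q s) (fun s => P' s → Q' s) := by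
  obtain ⟨φ, h₁, h₂⟩ := h
  obtain ⟨ψ, k₁, k₂⟩ := k
  exact ⟨⟨φ.imp ψ, fun v s hs => by rw [Language.Formula.realize_imp, h₁ v s hs, k₁ v s hs],
    fun v s hs => by rw [Language.Formula.realize_imp, h₂ v s hs, k₂ v s hs]⟩⟩

instance JDef.iff [h : JDef L M N P P'] [k : JDef L M N Q Q'] :
    JDef L M N (fun s => P s ↔ Q s) (fun s => P' s ↔ Q' s) := by
  obtain ⟨φ, h₁, h₂⟩ := h
  obtain ⟨ψ, k₁, k₂⟩ := k
  exact ⟨⟨φ.iff ψ, fun v s hs => by rw [Language.Formula.realize_iff, h₁ v s hs, k₁ v s hs],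
    fun v s hs => by rw [Language.Formula.realize_iff, h₂ v s hs, k₂ v s hs]⟩⟩

/-- A quantifier over an interpreted type becomes a block of quantifiers over code variables,
relativized to `dom` because not every tuple of elements is a code. Surjectivity of the coding
ensures that no element is missed. -/
instance JDef.ex {P : S → T → Prop} {P' : S' → T' → Prop}
    [h : JDef L M N (fun s : S × T => P s.1 s.2) (fun s : S' × T' => P' s.1 s.2)] :
    JDef L M N (fun s => ∃ t, P s t) (fun s => ∃ t, P' s t) := by
  obtain ⟨φ, h₁, h₂⟩ := h
  refine ⟨⟨(J.dom.relabel Sum.inr ⊓ φ).iExs J.Var, fun v s hs => ?_, fun v s hs => ?_⟩⟩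
  · simp only [Language.Formula.realize_iExs, Language.Formula.realize_inf,
      Language.Formula.realize_relabel, Sum.elim_comp_inr, J.dom_iff]
    constructor
    · rintro ⟨w, ⟨t, ht⟩, hw⟩
      exact ⟨t, (h₁ _ (s, t) ⟨by simpa using hs, by simpa using ht⟩).1 hw⟩
    · rintro ⟨t, hp⟩
      obtain ⟨w, ht⟩ := J.surj t
      exact ⟨w, ⟨t, ht⟩, (h₁ _ (s, t) ⟨by simpa using hs, by simpa using ht⟩).2 hp⟩
  · simp only [Language.Formula.realize_iExs, Language.Formula.realize_inf,
      Language.Formula.realize_relabel, Sum.elim_comp_inr, J.dom_iff']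
    constructor
    · rintro ⟨w, ⟨t, ht⟩, hw⟩
      exact ⟨t, (h₂ _ (s, t) ⟨by simpa using hs, by simpa using ht⟩).1 hw⟩
    · rintro ⟨t, hp⟩
      obtain ⟨w, ht⟩ := J.surj' t
      exact ⟨w, ⟨t, ht⟩, (h₂ _ (s, t) ⟨by simpa using hs, by simpa using ht⟩).2 hp⟩

instance JDef.all {P : S → T → Prop} {P' : S' → T' → Prop}
    [h : JDef L M N (fun s : S × T => P s.1 s.2) (fun s : S' × T' => P' s.1 s.2)] :
    JDef L M N (fun s => ∀ t, P s t) (fun s => ∀ t, P' s t) := by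
  have : JDef L M N (fun s => ¬ ∃ t, ¬ P s t) (fun s => ¬ ∃ t, ¬ P' s t) :=
    JDef.not (h := JDef.ex (h := JDef.not (h := h)))
  simpa only [not_exists, not_not] using this

theorem JDef.forallFin {k : ℕ} {P : Fin k → S → Prop} {P' : Fin k → S' → Prop}
    (h : ∀ i, JDef L M N (P i) (P' i)) :
    JDef L M N (fun s => ∀ i, P i s) (fun s => ∀ i, P' i s) := by
  choose φ h₁ h₂ using fun i => (h i).exists_formula
  refine ⟨⟨Language.Formula.iInf φ, fun v s hs => ?_, fun v s hs => ?_⟩⟩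
  · simp only [Language.Formula.realize_iInf]
    exact forall_congr' fun i => h₁ i v s hs
  · simp only [Language.Formula.realize_iInf]
    exact forall_congr' fun i => h₂ i v s hs

theorem JDef.realize {k : ℕ} (φ : L.Formula (Fin k)) :
    JDef L M N (fun v : Fin k → M => φ.Realize v) (fun v : Fin k → N => φ.Realize v) := by
  refine ⟨⟨φ.relabel fun i => (i, ()), fun v s hs => ?_, fun v s hs => ?_⟩⟩ <;>
  · rw [Language.Formula.realize_relabel, ← funext hs]
    rfl

theorem JDef.eq_self : JDef L M N (fun s : M × M => s.1 = s.2) (fun s : N × N => s.1 = s.2) := by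
  refine ⟨⟨Language.Term.equal (.var (Sum.inl ())) (.var (Sum.inr ())), ?_, ?_⟩⟩ <;>
  · rintro v ⟨s, t⟩ ⟨hs, ht⟩
    rw [Language.Formula.realize_equal, ← show _ = s from hs, ← show _ = t from ht]
    rfl

/-- Elementarily equivalent structures satisfy the same jointly definable sentences. -/
theorem JDef.transfer (h : L.ElementarilyEquivalent M N) {p q : Prop}
    (hpq : JDef L M N (fun _ : Unit => p) (fun _ : Unit => q)) : p ↔ q := by
  obtain ⟨φ, h₁, h₂⟩ := hpq
  -- A formula for a predicate on `Unit` has no free variables, so it is a sentence.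
  rw [← h₁ Empty.elim () trivial, ← h₂ Empty.elim () trivial]
  have := h.realize_sentence φ
  simpa only [Language.Sentence.Realize, Subsingleton.elim (default : Empty → _) Empty.elim]
    using this

end JointDefinability

/-! ## Joint definability of the vocabulary of list superstructures -/

section JointSubtypes

variable {L : FirstOrder.Language.{0, 0}} {M : Type v} {N : Type u} [L.Structure M] [L.Structure N]
variable {S S' : Type*} [I : Interp L M N S S']

/-- Elements of a sort code themselves, and the sort predicate serves as `dom`; quantifiers over a
sort are thus relativized quantifiers over the universe. -/
abbrev Interp.subtype (R : L.Relations 1) :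
    Interp L M N {a : M // Language.Structure.RelMap R ![a]}
      {a : N // Language.Structure.RelMap R ![a]} where
  Var := Unit
  finite := inferInstance
  code v s := v () = s
  code' v s := v () = s
  dom := R.formula ![.var ()]
  dom_iff v := by
    rw [Language.Formula.realize_rel,
      show (fun i => (![.var ()] i : L.Term Unit).realize v) = ![v ()] by ext i; fin_cases i; rfl]
    exact ⟨fun h => ⟨⟨_, h⟩, rfl⟩, fun ⟨s, h⟩ => h ▸ s.2⟩
  dom_iff' v := by
    rw [Language.Formula.realize_rel,
      show (fun i => (![.var ()] i : L.Term Unit).realize v) = ![v ()] by ext i; fin_cases i; rfl]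
    exact ⟨fun h => ⟨⟨_, h⟩, rfl⟩, fun ⟨s, h⟩ => h ▸ s.2⟩
  surj s := ⟨fun _ => s, rfl⟩
  surj' s := ⟨fun _ => s, rfl⟩

theorem JMap.coe (R : L.Relations 1)
    {f : S → {a : M // Language.Structure.RelMap R ![a]}}
    {f' : S' → {a : N // Language.Structure.RelMap R ![a]}}
    (h : @JMap L M N _ _ _ _ _ _ I (Interp.subtype R) f f') :
    JMap L M N (fun s => (f s : M)) (fun s => (f' s : N)) := by
  obtain ⟨τ, h₁, h₂⟩ := h
  exact ⟨⟨τ, h₁, h₂⟩⟩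

theorem JMap.const (c : L.Constants) :
    JMap L M N (fun _ : S => (Language.Structure.funMap c ![] : M))
      (fun _ : S' => (Language.Structure.funMap c ![] : N)) :=
  ⟨⟨fun _ => Language.Constants.term c,
    fun _ _ _ => congrArg (Language.Structure.funMap c) (Subsingleton.elim _ _),
    fun _ _ _ => congrArg (Language.Structure.funMap c) (Subsingleton.elim _ _)⟩⟩

theorem JDef.realize_comp {k : ℕ} (φ : L.Formula (Fin k)) {f : S → Fin k → M} {f' : S' → Fin k → N}
    (h : ∀ i, JMap L M N (fun s => f s i) (fun s => f' s i)) :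
    JDef L M N (fun s => φ.Realize (f s)) (fun s => φ.Realize (f' s)) :=
  (JDef.realize φ).comp f f' (hf := JMap.pi h)

theorem JDef.rel {k : ℕ} (R : L.Relations k) {f : S → Fin k → M} {f' : S' → Fin k → N}
    (h : ∀ i, JMap L M N (fun s => f s i) (fun s => f' s i)) :
    JDef L M N (fun s => Language.Structure.RelMap R (f s))
      (fun s => Language.Structure.RelMap R (f' s)) := by
  simpa only [Language.Formula.realize_rel, Language.Term.realize_var] using
    JDef.realize_comp (R.formula Language.Term.var) h

instance JDef.eq {f g : S → M} {f' g' : S' → N} [JMap L M N f f'] [JMap L M N g g'] :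
    JDef L M N (fun s => f s = g s) (fun s => f' s = g' s) :=
  JDef.eq_self.comp₂ _ _ _ _

theorem JDef.eq_coe (R : L.Relations 1)
    {f g : S → {a : M // Language.Structure.RelMap R ![a]}}
    {f' g' : S' → {a : N // Language.Structure.RelMap R ![a]}}
    (hf : @JMap L M N _ _ _ _ _ _ I (Interp.subtype R) f f')
    (hg : @JMap L M N _ _ _ _ _ _ I (Interp.subtype R) g g') :
    JDef L M N (fun s => f s = g s) (fun s => f' s = g' s) := by
  have := JMap.coe R hf
  have := JMap.coe R hg
  simp only [Subtype.ext_iff]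
  infer_instance

variable {f g h : S → M} {f' g' h' : S' → N}
  [hf : JMap L M N f f'] [hg : JMap L M N g g'] [hh : JMap L M N h h']

instance JDef.realize₂ (φ : L.Formula (Fin 2)) :
    JDef L M N (fun s => φ.Realize ![f s, g s]) (fun s => φ.Realize ![f' s, g' s]) :=
  JDef.realize_comp φ fun i => by fin_cases i <;> assumption

instance JDef.realize₃ (φ : L.Formula (Fin 3)) :
    JDef L M N (fun s => φ.Realize ![f s, g s, h s]) (fun s => φ.Realize ![f' s, g' s, h' s]) :=
  JDef.realize_comp φ fun i => by fin_cases i <;> assumption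

theorem JDef.rel₂ (R : L.Relations 2) :
    JDef L M N (fun s => Language.Structure.RelMap R ![f s, g s])
      (fun s => Language.Structure.RelMap R ![f' s, g' s]) :=
  JDef.rel R fun i => by fin_cases i <;> assumption

theorem JDef.rel₃ (R : L.Relations 3) :
    JDef L M N (fun s => Language.Structure.RelMap R ![f s, g s, h s])
      (fun s => Language.Structure.RelMap R ![f' s, g' s, h' s]) :=
  JDef.rel R fun i => by fin_cases i <;> assumption

end JointSubtypes

/-! ### Sorts, operations and coefficient lists -/

section JointVocabulary

set_option synthInstance.maxHeartbeats 0
set_option synthInstance.maxSize 100000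
set_option maxHeartbeats 0


variable {M : Type v} {N : Type u} [listLang.Structure M] [listLang.Structure N]
variable {S S' : Type*} [I : Interp listLang M N S S']

section Sorts

instance : Interp listLang M N (FieldSort M) (FieldSort N) :=
  Interp.subtype (L := listLang) ListRel.isField

instance : Interp listLang M N (ListSort M) (ListSort N) :=
  Interp.subtype (L := listLang) ListRel.isList

instance : Interp listLang M N (NumSort M) (NumSort N) :=
  Interp.subtype (L := listLang) ListRel.isNum

instance {f : S → FieldSort M} {f' : S' → FieldSort N} [h : JMap listLang M N f f'] :
    JMap listLang M N (fun s => (f s : M)) (fun s => (f' s : N)) :=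
  JMap.coe (L := listLang) ListRel.isField h

instance {f : S → ListSort M} {f' : S' → ListSort N} [h : JMap listLang M N f f'] :
    JMap listLang M N (fun s => (f s : M)) (fun s => (f' s : N)) :=
  JMap.coe (L := listLang) ListRel.isList h

instance {f : S → NumSort M} {f' : S' → NumSort N} [h : JMap listLang M N f f'] :
    JMap listLang M N (fun s => (f s : M)) (fun s => (f' s : N)) :=
  JMap.coe (L := listLang) ListRel.isNum h

instance {f g : S → NumSort M} {f' g' : S' → NumSort N} [hf : JMap listLang M N f f']
    [hg : JMap listLang M N g g'] :
    JDef listLang M N (fun s => f s = g s) (fun s => f' s = g' s) :=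
  JDef.eq_coe (L := listLang) ListRel.isNum hf hg

end Sorts

instance : JMap listLang M N (fun _ : S => zeroF M) (fun _ : S' => zeroF N) :=
  JMap.const (L := listLang) ListConst.zeroF

instance : JMap listLang M N (fun _ : S => oneN M) (fun _ : S' => oneN N) :=
  JMap.const (L := listLang) ListConst.oneN

section Raw

variable {f g h : S → M} {f' g' h' : S' → N}
  [JMap listLang M N f f'] [JMap listLang M N g g'] [JMap listLang M N h h']

instance : JDef listLang M N (fun s => AddF (f s) (g s) (h s))
    (fun s => AddF (f' s) (g' s) (h' s)) :=
  JDef.rel₃ (L := listLang) ListRel.addF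

instance : JDef listLang M N (fun s => MulF (f s) (g s) (h s))
    (fun s => MulF (f' s) (g' s) (h' s)) :=
  JDef.rel₃ (L := listLang) ListRel.mulF

instance : JDef listLang M N (fun s => AddN (f s) (g s) (h s))
    (fun s => AddN (f' s) (g' s) (h' s)) :=
  JDef.rel₃ (L := listLang) ListRel.addN

instance : JDef listLang M N (fun s => MulN (f s) (g s) (h s))
    (fun s => MulN (f' s) (g' s) (h' s)) :=
  JDef.rel₃ (L := listLang) ListRel.mulN

instance : JDef listLang M N (fun s => Entry (f s) (g s) (h s))
    (fun s => Entry (f' s) (g' s) (h' s)) :=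
  JDef.rel₃ (L := listLang) ListRel.entry

instance : JDef listLang M N (fun s => Len (f s) (g s)) (fun s => Len (f' s) (g' s)) :=
  JDef.rel₂ (L := listLang) ListRel.len

instance : JDef listLang M N (fun s => Le (f s) (g s)) (fun s => Le (f' s) (g' s)) := by
  have : JDef listLang M N (fun p : M × M => Le p.1 p.2)
      (fun p : N × N => Le p.1 p.2) := by
    unfold Le; infer_instance
  exact this.comp₂ _ _ _ _

instance : JDef listLang M N (fun s => Lt (f s) (g s)) (fun s => Lt (f' s) (g' s)) := by
  have : JDef listLang M N (fun p : M × M => Lt p.1 p.2)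
      (fun p : N × N => Lt p.1 p.2) := by
    unfold Lt; infer_instance
  exact this.comp₂ _ _ _ _

end Raw

variable {a b c : S → ListSort M} {a' b' c' : S' → ListSort N}
  [JMap listLang M N a a'] [JMap listLang M N b b'] [JMap listLang M N c c']
  {i j l : S → NumSort M} {i' j' l' : S' → NumSort N}
  [JMap listLang M N i i'] [JMap listLang M N j j'] [JMap listLang M N l l']
  {x : S → FieldSort M} {x' : S' → FieldSort N} [JMap listLang M N x x']

instance : JDef listLang M N (fun s => Coef (a s) (i s) (x s))
    (fun s => Coef (a' s) (i' s) (x' s)) := by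
  have : JDef listLang M N (fun p : ListSort M × NumSort M × FieldSort M => Coef p.1 p.2.1 p.2.2)
      (fun p : ListSort N × NumSort N × FieldSort N => Coef p.1 p.2.1 p.2.2) := by
    unfold Coef; infer_instance
  exact this.comp₃ _ _ _ _ _ _

instance : JDef listLang M N (fun s => TailEq (a s) (b s)) (fun s => TailEq (a' s) (b' s)) := by
  have : JDef listLang M N (fun p : ListSort M × ListSort M => TailEq p.1 p.2)
      (fun p : ListSort N × ListSort N => TailEq p.1 p.2) := by
    unfold TailEq; infer_instance
  exact this.comp₂ _ _ _ _

instance : JDef listLang M N (fun s => IsSum (a s) (x s)) (fun s => IsSum (a' s) (x' s)) := by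
  have : JDef listLang M N (fun p : ListSort M × FieldSort M => IsSum p.1 p.2)
      (fun p : ListSort N × FieldSort N => IsSum p.1 p.2) := by
    unfold IsSum; infer_instance
  exact this.comp₂ _ _ _ _

instance : JDef listLang M N (fun s => ListAdd (a s) (b s) (c s))
    (fun s => ListAdd (a' s) (b' s) (c' s)) := by
  have : JDef listLang M N (fun p : ListSort M × ListSort M × ListSort M => ListAdd p.1 p.2.1 p.2.2)
      (fun p : ListSort N × ListSort N × ListSort N => ListAdd p.1 p.2.1 p.2.2) := by
    unfold ListAdd; infer_instance
  exact this.comp₃ _ _ _ _ _ _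

/-- The ternary relations `mon` and `mon'` on numbers are defined by the same formula. -/
class JMon (mon : NumSort M → NumSort M → NumSort M → Prop)
    (mon' : NumSort N → NumSort N → NumSort N → Prop) : Prop where
  jdef : JDef listLang M N (fun p : NumSort M × NumSort M × NumSort M => mon p.1 p.2.1 p.2.2)
    (fun p : NumSort N × NumSort N × NumSort N => mon' p.1 p.2.1 p.2.2)

variable {mon : NumSort M → NumSort M → NumSort M → Prop}
  {mon' : NumSort N → NumSort N → NumSort N → Prop} [hmon : JMon mon mon']

instance : JDef listLang M N (fun s => mon (i s) (j s) (l s))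
    (fun s => mon' (i' s) (j' s) (l' s)) :=
  hmon.jdef.comp₃ _ _ _ _ _ _

instance : JDef listLang M N (fun s => ListMul mon (a s) (b s) (c s))
    (fun s => ListMul mon' (a' s) (b' s) (c' s)) := by
  have : JDef listLang M N
    (fun p : ListSort M × ListSort M × ListSort M => ListMul mon p.1 p.2.1 p.2.2)
      (fun p : ListSort N × ListSort N × ListSort N => ListMul mon' p.1 p.2.1 p.2.2) := by
    unfold ListMul; infer_instance
  exact this.comp₃ _ _ _ _ _ _

instance : JMon (monSingle M) (monSingle N) := ⟨by unfold monSingle; infer_instance⟩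

instance JDef.realize_cons {k : ℕ} (φ : listLang.Formula (Fin (k + 1)))
    {t : S → Fin k → NumSort M} {t' : S' → Fin k → NumSort N} [ht : JMap listLang M N t t'] :
    JDef listLang M N (fun s => φ.Realize (M := M) (Fin.cons (i s : M) fun r => (t s r : M)))
      (fun s => φ.Realize (M := N) (Fin.cons (i' s : N) fun r => (t' s r : N))) := by
  refine JDef.realize_comp φ fun r => ?_
  refine Fin.cases ?_ (fun r => ?_) r <;> simp only [Fin.cons_zero, Fin.cons_succ] <;>
    infer_instance

instance JDef.addN_tuple {k : ℕ} {t u w : S → Fin k → NumSort M} {t' u' w' : S' → Fin k → NumSort N}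
    [JMap listLang M N t t'] [JMap listLang M N u u'] [JMap listLang M N w w'] :
    JDef listLang M N (fun s => ∀ r, AddN (t s r : M) (u s r) (w s r))
      (fun s => ∀ r, AddN (t' s r : N) (u' s r) (w' s r)) :=
  JDef.forallFin fun _ => inferInstance

instance {F : Type*} [Field F] {k : ℕ} (E : MonomialEnum F k) : JMon (E.mon M) (E.mon N) := by
  constructor
  unfold MonomialEnum.mon
  infer_instance

end JointVocabulary

/-! ## Rings given by the graphs of their operations -/

section RelationalRings

variable {X : Type*}

/-- The axioms of commutative rings, for the graphs `A` of addition and `B` of multiplication. -/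
def IsCommRingRel (A B : X → X → X → Prop) : Prop :=
  (∀ p q, ∃ r, A p q r) ∧ (∀ p q r s, A p q r → A p q s → r = s) ∧
  (∀ p q r, A p q r → A q p r) ∧
  (∀ p q r s t u, A p q s → A s r t → A q r u → A p u t) ∧
  (∃ z, (∀ p, A z p p) ∧ ∀ p, ∃ q, A q p z) ∧
  (∀ p q, ∃ r, B p q r) ∧ (∀ p q r s, B p q r → B p q s → r = s) ∧
  (∀ p q r, B p q r → B q p r) ∧
  (∀ p q r s t u, B p q s → B s r t → B q r u → B p u t) ∧
  (∃ o, ∀ p, B o p p) ∧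
  (∀ p q r s t u w, A q r s → B p s t → B p q u → B p r w → A u w t)

/-- The right side quantifies over ring structures, which is not first-order, while the left side
only quantifies over elements. Totality and single-valuedness of the graphs are among the axioms, so
transferring them also shows that the operations are well defined on classes. -/
theorem isCommRingRel_iff {A B : X → X → X → Prop} : IsCommRingRel A B ↔
    ∃ _ : CommRing X, (∀ p q r, p + q = r ↔ A p q r) ∧ ∀ p q r, p * q = r ↔ B p q r := by
  constructor
  · rintro ⟨a₁, a₂, a₃, a₄, ⟨z, a₅, a₆⟩, b₁, b₂, b₃, b₄, ⟨o, b₅⟩, c⟩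
    choose add hadd using a₁
    choose mul hmul using b₁
    choose neg hneg using a₆
    have add_iff : ∀ p q r, add p q = r ↔ A p q r :=
      fun p q r => ⟨fun h => h ▸ hadd p q, a₂ _ _ _ _ (hadd p q)⟩
    have mul_iff : ∀ p q r, mul p q = r ↔ B p q r :=
      fun p q r => ⟨fun h => h ▸ hmul p q, b₂ _ _ _ _ (hmul p q)⟩
    have zero_add : ∀ p, add z p = p := fun p => (add_iff _ _ _).2 (a₅ p)
    have one_mul : ∀ p, mul o p = p := fun p => (mul_iff _ _ _).2 (b₅ p)
    have mul_comm : ∀ p q, mul p q = mul q p := fun p q => (mul_iff _ _ _).2 (b₃ _ _ _ (hmul q p))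
    have left_distrib : ∀ p q r, mul p (add q r) = add (mul p q) (mul p r) := fun p q r =>
      ((add_iff _ _ _).2 (c p q r _ _ _ _ (hadd q r) (hmul _ _) (hmul _ _) (hmul _ _))).symm
    let _ : Add X := ⟨add⟩
    let _ : Mul X := ⟨mul⟩
    let _ : Neg X := ⟨neg⟩
    let _ : Zero X := ⟨z⟩
    let _ : One X := ⟨o⟩
    exact ⟨CommRing.ofMinimalAxioms
      (fun p q r => ((add_iff _ _ _).2 (a₄ _ _ _ _ _ _ (hadd p q) (hadd _ r) (hadd q r))).symm)
      zero_add (fun p => (add_iff _ _ _).2 (hneg p))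
      (fun p q r => ((mul_iff _ _ _).2 (b₄ _ _ _ _ _ _ (hmul p q) (hmul _ r) (hmul q r))).symm)
      mul_comm one_mul left_distrib, add_iff, mul_iff⟩
  · rintro ⟨_, hA, hB⟩
    refine ⟨?_, ?_, ?_, ?_, ⟨0, ?_, fun p => ⟨-p, ?_⟩⟩, ?_, ?_, ?_, ?_, ⟨1, ?_⟩, ?_⟩ <;>
      simp only [← hA, ← hB]
    · exact fun p q => ⟨_, rfl⟩
    · exact fun p q r s h k => h.symm.trans k
    · exact fun p q r h => (add_comm q p).trans h
    · rintro p q r s t u rfl rfl rfl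
      exact (add_assoc p q r).symm
    · exact zero_add
    · exact neg_add_cancel p
    · exact fun p q => ⟨_, rfl⟩
    · exact fun p q r s h k => h.symm.trans k
    · exact fun p q r h => (mul_comm q p).trans h
    · rintro p q r s t u rfl rfl rfl
      exact (mul_assoc p q r).symm
    · exact one_mul
    · rintro p q r s t u w rfl rfl rfl rfl
      exact (mul_add p q r).symm

end RelationalRings

/-! ## Joint definability of the ring of nonstandard polynomials -/

section JointPolynomials

variable {M : Type v} {N : Type u} [listLang.Structure M] [listLang.Structure N]

theorem NPoly.mk_eq_mk {s t : ListSort M} : NPoly.mk s = NPoly.mk t ↔ TailEq s t :=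
  Equivalence.quot_mk_eq_iff ⟨fun _ _ _ => Iff.rfl, fun h j a => (h j a).symm,
    fun h k j a => (h j a).trans (k j a)⟩ s t

theorem NPoly.exists_mk (p : NPoly M) : ∃ s, NPoly.mk s = p := Quot.exists_rep p

/-- The graph of addition of nonstandard polynomials. -/
def AddRel (p q r : NPoly M) : Prop :=
  ∃ a b c : ListSort M, NPoly.mk a = p ∧ NPoly.mk b = q ∧ NPoly.mk c = r ∧ ListAdd a b c

/-- The graph of multiplication of nonstandard polynomials. -/
def MulRel (mon : NumSort M → NumSort M → NumSort M → Prop) (p q r : NPoly M) : Prop :=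
  ∃ a b c : ListSort M, NPoly.mk a = p ∧ NPoly.mk b = q ∧ NPoly.mk c = r ∧ ListMul mon a b c

/-- Every representative of a class is a code of it: codes need not be unique, so quotients are
interpreted without choosing normal forms. -/
instance : Interp listLang M N (NPoly M) (NPoly N) where
  Var := Unit
  finite := inferInstance
  code v p := ∃ h, NPoly.mk ⟨v (), h⟩ = p
  code' v p := ∃ h, NPoly.mk ⟨v (), h⟩ = p
  dom := (inferInstance : Interp listLang M N (ListSort M) (ListSort N)).dom
  dom_iff v := by
    rw [Interp.dom_iff (S := ListSort M) (S' := ListSort N) (N := N)]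
    exact ⟨fun ⟨s, h⟩ => ⟨NPoly.mk s, h ▸ s.2, by congr 1; exact Subtype.ext h⟩,
      fun ⟨p, h, _⟩ => ⟨⟨_, h⟩, rfl⟩⟩
  dom_iff' v := by
    rw [Interp.dom_iff' (S := ListSort M) (S' := ListSort N) (M := M)]
    exact ⟨fun ⟨s, h⟩ => ⟨NPoly.mk s, h ▸ s.2, by congr 1; exact Subtype.ext h⟩,
      fun ⟨p, h, _⟩ => ⟨⟨_, h⟩, rfl⟩⟩
  surj p := by
    obtain ⟨s, rfl⟩ := p.exists_mk
    exact ⟨fun _ => s, s.2, rfl⟩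
  surj' p := by
    obtain ⟨s, rfl⟩ := p.exists_mk
    exact ⟨fun _ => s, s.2, rfl⟩

variable {S S' : Type*} [I : Interp listLang M N S S']

instance {a : S → ListSort M} {a' : S' → ListSort N} [h : JMap listLang M N a a'] :
    JMap listLang M N (fun s => NPoly.mk (a s)) (fun s => NPoly.mk (a' s)) := by
  obtain ⟨τ, h₁, h₂⟩ := h
  refine ⟨⟨τ, fun v s hs => ?_, fun v s hs => ?_⟩⟩
  · have := h₁ v s hs
    exact ⟨this ▸ (a s).2, congrArg NPoly.mk (Subtype.ext this)⟩
  · have := h₂ v s hs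
    exact ⟨this ▸ (a' s).2, congrArg NPoly.mk (Subtype.ext this)⟩

/-- Equality of classes is not equality of their codes; the formula that defines it is the one for
`TailEq`. -/
theorem JDef.eq_npoly : JDef listLang M N (fun p : NPoly M × NPoly M => p.1 = p.2)
    (fun p : NPoly N × NPoly N => p.1 = p.2) := by
  have h : JDef listLang M N (fun p : ListSort M × ListSort M => TailEq p.1 p.2)
    (fun p : ListSort N × ListSort N => TailEq p.1 p.2) := inferInstance
  obtain ⟨φ, h₁, h₂⟩ := h
  refine ⟨⟨φ, ?_, ?_⟩⟩
  · rintro v ⟨_, _⟩ ⟨⟨hp, rfl⟩, ⟨hq, rfl⟩⟩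
    exact (h₁ v (⟨_, hp⟩, ⟨_, hq⟩) ⟨rfl, rfl⟩).trans NPoly.mk_eq_mk.symm
  · rintro v ⟨_, _⟩ ⟨⟨hp, rfl⟩, ⟨hq, rfl⟩⟩
    exact (h₂ v (⟨_, hp⟩, ⟨_, hq⟩) ⟨rfl, rfl⟩).trans NPoly.mk_eq_mk.symm

variable {p q r : S → NPoly M} {p' q' r' : S' → NPoly N}
  [JMap listLang M N p p'] [JMap listLang M N q q'] [JMap listLang M N r r']

instance : JDef listLang M N (fun s => p s = q s) (fun s => p' s = q' s) :=
  JDef.eq_npoly.comp₂ _ _ _ _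

variable {mon : NumSort M → NumSort M → NumSort M → Prop}
  {mon' : NumSort N → NumSort N → NumSort N → Prop} [hmon : JMon mon mon']

set_option synthInstance.maxHeartbeats 0
set_option synthInstance.maxSize 100000
set_option maxHeartbeats 0

instance : JDef listLang M N (fun s => AddRel (p s) (q s) (r s))
    (fun s => AddRel (p' s) (q' s) (r' s)) := by
  have : JDef listLang M N (fun p : NPoly M × NPoly M × NPoly M => AddRel p.1 p.2.1 p.2.2)
      (fun p : NPoly N × NPoly N × NPoly N => AddRel p.1 p.2.1 p.2.2) := by
    unfold AddRel; infer_instance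
  exact this.comp₃ _ _ _ _ _ _

instance : JDef listLang M N (fun s => MulRel mon (p s) (q s) (r s))
    (fun s => MulRel mon' (p' s) (q' s) (r' s)) := by
  have : JDef listLang M N (fun p : NPoly M × NPoly M × NPoly M => MulRel mon p.1 p.2.1 p.2.2)
      (fun p : NPoly N × NPoly N × NPoly N => MulRel mon' p.1 p.2.1 p.2.2) := by
    unfold MulRel; infer_instance
  exact this.comp₃ _ _ _ _ _ _

variable (mon mon') in
theorem exists_isPolyRing_iff (h : listLang.ElementarilyEquivalent M N) :
    (∃ _ : CommRing (NPoly M), IsPolyRing mon) ↔ ∃ _ : CommRing (NPoly N), IsPolyRing mon' := by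
  have : JDef listLang M N (fun _ : Unit => IsCommRingRel (AddRel (M := M)) (MulRel mon))
      (fun _ : Unit => IsCommRingRel (AddRel (M := N)) (MulRel mon')) := by
    unfold IsCommRingRel; infer_instance
  exact isCommRingRel_iff.symm.trans ((JDef.transfer h this).trans isCommRingRel_iff)

end JointPolynomials

/-! ## Nonstandard tuples through their codes -/

section Codes

variable {M : Type v} [listLang.Structure M]

/-- `i` lies in the interval `[1, n]`. -/
def InIdx (n i : NumSort M) : Prop := Le (oneN M) (i : M) ∧ Le (i : M) n

/-- The `i`-th block of length `m` of the list `A` holds the coefficients of `p`. -/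
def Blk (A : ListSort M) (m i : NumSort M) (p : NPoly M) : Prop :=
  ∃ s : ListSort M, NPoly.mk s = p ∧
    ∀ (j : NumSort M) (a : FieldSort M),
      (Lt (j : M) m → (Coef s j a ↔ ∃ i' b q : NumSort M,
        AddN (i' : M) (oneN M) i ∧ MulN (i' : M) m b ∧ AddN (b : M) j q ∧ Coef A q a)) ∧
      (¬ Lt (j : M) m → (Coef s j a ↔ (a : M) = zeroF M))

/-- The list `A` has length `n * m`. -/
def HasBlocks (n : NumSort M) (A : ListSort M) (m : NumSort M) : Prop :=
  ∃ N : NumSort M, MulN (n : M) m N ∧ Len (A : M) N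

/-- The list `A`, in blocks of length `m`, is a code of the tuple `P`. -/
def IsCode {n : NumSort M} (P : Idx n → NPoly M) (A : ListSort M) (m : NumSort M) : Prop :=
  HasBlocks n A m ∧ ∀ i : Idx n, Blk A m i.1 (P i)

theorem isNonstdTuple_iff {n : NumSort M} {P : Idx n → NPoly M} :
    IsNonstdTuple P ↔ ∃ A m, IsCode P A m :=
  ⟨fun ⟨A, m, N, h, k, l⟩ => ⟨A, m, ⟨N, h, k⟩, l⟩, fun ⟨A, m, ⟨N, h, k⟩, l⟩ => ⟨A, m, N, h, k, l⟩⟩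

/-- The block fixes the coefficients below `m` and the others vanish, so the class is determined.
Hence a code determines its tuple. -/
theorem Blk.unique {A : ListSort M} {m i : NumSort M} {p q : NPoly M} (hp : Blk A m i p)
    (hq : Blk A m i q) : p = q := by
  obtain ⟨s, rfl, hs⟩ := hp
  obtain ⟨t, rfl, ht⟩ := hq
  refine NPoly.mk_eq_mk.2 fun j a => ?_
  by_cases h : Lt (j : M) m
  · rw [(hs j a).1 h, (ht j a).1 h]
  · rw [(hs j a).2 h, (ht j a).2 h]

theorem IsCode.blk_iff {n : NumSort M} {P : Idx n → NPoly M} {A : ListSort M} {m : NumSort M}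
    (h : IsCode P A m) (i : Idx n) {p : NPoly M} : Blk A m i.1 p ↔ p = P i :=
  ⟨fun k => k.unique (h.2 i), fun k => k ▸ h.2 i⟩

/-- This trades a statement about the external function `P` for one that quantifies over elements
only. -/
theorem IsCode.forall_iff {n : NumSort M} {P : Idx n → NPoly M} {A : ListSort M} {m : NumSort M}
    (h : IsCode P A m) {φ : NPoly M → Prop} :
    (∀ i, InIdx n i → ∃ p, φ p ∧ Blk A m i p) ↔ ∀ i, φ (P i) := by
  constructor
  · intro k i
    obtain ⟨p, hp, hb⟩ := k i.1 i.2
    exact (h.blk_iff i).1 hb ▸ hp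
  · exact fun k i hi => ⟨_, k ⟨i, hi⟩, h.2 ⟨i, hi⟩⟩

/-- The function is chosen externally, block by block; it needs no definability, since its code `A`,
`m` is already given in `M`. -/
theorem HasBlocks.exists_isCode {n : NumSort M} {A : ListSort M} {m : NumSort M}
    (h : HasBlocks n A m) {φ : NPoly M → Prop} (k : ∀ i, InIdx n i → ∃ p, φ p ∧ Blk A m i p) :
    ∃ P : Idx n → NPoly M, IsCode P A m := by
  choose p hp using k
  exact ⟨fun i => p i.1 i.2, h, fun i => (hp i.1 i.2).2⟩

variable (mon : NumSort M → NumSort M → NumSort M → Prop)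

/-- `o` is the one of the ring. -/
def OneRel (o : NPoly M) : Prop := ∀ p, MulRel mon o p p

/-- `p` is a unit. -/
def UnitRel (p : NPoly M) : Prop := ∃ q o, OneRel mon o ∧ MulRel mon p q o

/-- `p` is irreducible. -/
def IrrRel (p : NPoly M) : Prop :=
  ¬ UnitRel mon p ∧ ∀ a b, MulRel mon a b p → UnitRel mon a ∨ UnitRel mon b

/-- `q` is the product of the tuple with `n` entries that is coded by `A`. -/
def ProdRel (n : NumSort M) (A : ListSort M) (m : NumSort M) (q : NPoly M) : Prop :=
  ∃ (B : ListSort M) (l : NumSort M), HasBlocks n B l ∧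
    (∀ i, InIdx n i → ∃ p, True ∧ Blk B l i p) ∧
    (∀ i, InIdx n i → (i : M) = oneN M → ∀ p, Blk A m i p → Blk B l i p) ∧
    (∀ i i', InIdx n i → InIdx n i' → AddN (i : M) (oneN M) i' →
      ∀ p s r, Blk B l i p → Blk A m i' s → MulRel mon p s r → Blk B l i' r) ∧
    InIdx n n ∧ Blk B l n q

/-- Every polynomial that is neither zero nor a unit has a factorization, in terms of codes. -/
def ExistsFactorizationRel : Prop :=
  ∀ q : NPoly M, ¬ AddRel q q q → ¬ UnitRel mon q → ∃ (n : NumSort M) (A : ListSort M)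
    (m : NumSort M), HasBlocks n A m ∧ (∀ i, InIdx n i → ∃ p, IrrRel mon p ∧ Blk A m i p) ∧
      ProdRel mon n A m q

/-- The tuples coded by `A` and `B` agree up to a permutation and units. -/
def EqUpToPermAndUnitsRel {F : Type u} [Field F] (T : TupleEnum F) (n : NumSort M) (A : ListSort M)
    (a : NumSort M) (m : NumSort M) (B : ListSort M) (b : NumSort M) : Prop :=
  n = m ∧ ∃ (c : NumSort M) (C : ListSort M) (d : NumSort M),
    (T.L.Realize (M := M) ![(c : M), (n : M)] ∧
      (∀ i, InIdx n i → ∃ x, InIdx m x ∧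
        ∀ y : NumSort M, T.T.Realize (M := M) ![(c : M), (y : M), (i : M)] ↔ y = x) ∧
      (∀ i j x : NumSort M, InIdx n i → InIdx n j →
        T.T.Realize (M := M) ![(c : M), (x : M), (i : M)] →
        T.T.Realize (M := M) ![(c : M), (x : M), (j : M)] → i = j) ∧
      ∀ x, InIdx m x → ∃ i, InIdx n i ∧ T.T.Realize (M := M) ![(c : M), (x : M), (i : M)]) ∧
    HasBlocks n C d ∧ (∀ i, InIdx n i → ∃ p, UnitRel mon p ∧ Blk C d i p) ∧
    (∃ o, OneRel mon o ∧ ProdRel mon n C d o) ∧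
    ∀ i x : NumSort M, InIdx n i → T.T.Realize (M := M) ![(c : M), (x : M), (i : M)] →
      ∀ p u s, Blk A a i p → Blk C d i u → Blk B b x s → MulRel mon u s p

/-- Factorizations are unique up to a permutation and units, in terms of codes. -/
def UniqueFactorizationRel {F : Type u} [Field F] (T : TupleEnum F) : Prop :=
  ∀ (q : NPoly M) (n m : NumSort M) (A : ListSort M) (a : NumSort M) (B : ListSort M)
    (b : NumSort M),
    (HasBlocks n A a ∧ (∀ i, InIdx n i → ∃ p, IrrRel mon p ∧ Blk A a i p) ∧ ProdRel mon n A a q) →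
    (HasBlocks m B b ∧ (∀ i, InIdx m i → ∃ p, IrrRel mon p ∧ Blk B b i p) ∧ ProdRel mon m B b q) →
    EqUpToPermAndUnitsRel mon T n A a m B b

end Codes

/-! ### Translation between tuples and codes -/

section Translation

variable {M : Type v} [listLang.Structure M] [CommRing (NPoly M)]
  {mon : NumSort M → NumSort M → NumSort M → Prop}

theorem IsPolyRing.mulRel_iff (h : IsPolyRing mon) {p q r : NPoly M} :
    MulRel mon p q r ↔ p * q = r :=
  (h.2 p q r).symm

theorem IsPolyRing.addRel_self_iff (h : IsPolyRing mon) {p : NPoly M} : AddRel p p p ↔ p = 0 :=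
  (h.1 p p p).symm.trans add_eq_left

theorem IsPolyRing.oneRel_iff (h : IsPolyRing mon) {p : NPoly M} : OneRel mon p ↔ p = 1 := by
  simp only [OneRel, h.mulRel_iff]
  exact ⟨fun k => by simpa using k 1, fun k q => by rw [k, one_mul]⟩

theorem IsPolyRing.unitRel_iff (h : IsPolyRing mon) {p : NPoly M} : UnitRel mon p ↔ IsUnit p := by
  simp only [UnitRel, h.oneRel_iff, h.mulRel_iff, exists_eq_left, isUnit_iff_exists_inv]

theorem IsPolyRing.irrRel_iff (h : IsPolyRing mon) {p : NPoly M} :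
    IrrRel mon p ↔ Irreducible p := by
  simp only [IrrRel, h.unitRel_iff, h.mulRel_iff, irreducible_iff, eq_comm]

/-- The external tuple of partial products corresponds to its code `B`, `l`; uniqueness of blocks
turns the conditions on `B` into the recursion for partial products, and back. -/
theorem IsPolyRing.prodRel_iff (h : IsPolyRing mon)
    {n : NumSort M} {P : Idx n → NPoly M} {A : ListSort M}
    {m : NumSort M} (hP : IsCode P A m) {q : NPoly M} :
    ProdRel mon n A m q ↔ IsNonstdProd P q := by
  simp only [ProdRel, IsNonstdProd, h.mulRel_iff]
  constructor
  · rintro ⟨B, l, hB, k₁, k₂, k₃, k₄, k₅⟩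
    obtain ⟨S, hS⟩ := hB.exists_isCode k₁
    refine ⟨S, isNonstdTuple_iff.2 ⟨B, l, hS⟩, fun i hi => ?_, fun i i' hi => ?_,
      ⟨n, k₄⟩, rfl, ((hS.blk_iff ⟨n, k₄⟩).1 k₅).symm⟩
    · exact ((hS.blk_iff i).1 (k₂ i.1 i.2 hi _ (hP.2 i))).symm
    · exact ((hS.blk_iff i').1 (k₃ i.1 i'.1 i.2 i'.2 hi _ _ _ (hS.2 i) (hP.2 i') rfl)).symm
  · rintro ⟨S, hS, k₁, k₂, ⟨i, hn⟩, hi, k₃⟩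
    have hi : i = n := hi
    subst hi
    obtain ⟨B, l, hS⟩ := isNonstdTuple_iff.1 hS
    refine ⟨B, l, hS.1, fun i hi => ⟨_, trivial, hS.2 ⟨i, hi⟩⟩, fun j hj hj' p hp => ?_,
      fun j j' hj hj' e p s r hp hs hr => ?_, hn, (hS.blk_iff ⟨_, hn⟩).2 k₃.symm⟩
    · rw [hS.blk_iff ⟨j, hj⟩, k₁ ⟨j, hj⟩ hj', ← hP.blk_iff]
      exact hp
    · rw [hS.blk_iff ⟨j', hj'⟩, k₂ ⟨j, hj⟩ ⟨j', hj'⟩ e, ← (hS.blk_iff ⟨j, hj⟩).1 hp,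
        ← (hP.blk_iff ⟨j', hj'⟩).1 hs, hr]

theorem IsPolyRing.isNonstdFactorization_iff (h : IsPolyRing mon)
    {n : NumSort M} {P : Idx n → NPoly M} {A : ListSort M}
    {m : NumSort M} (hP : IsCode P A m) {q : NPoly M} :
    (HasBlocks n A m ∧ (∀ i, InIdx n i → ∃ p, IrrRel mon p ∧ Blk A m i p) ∧ ProdRel mon n A m q) ↔
      IsNonstdFactorization P q := by
  rw [hP.forall_iff, h.prodRel_iff hP]
  simp only [h.irrRel_iff]
  exact ⟨fun k => ⟨isNonstdTuple_iff.2 ⟨A, m, hP⟩, k.2⟩, fun k => ⟨hP.1, k.2⟩⟩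

theorem IsPolyRing.existsFactorizationRel_iff (h : IsPolyRing mon) : ExistsFactorizationRel mon ↔
    ∀ q : NPoly M, q ≠ 0 → ¬ IsUnit q →
      ∃ (n : NumSort M) (P : Idx n → NPoly M), IsNonstdFactorization P q := by
  simp only [ExistsFactorizationRel, h.addRel_self_iff, h.unitRel_iff]
  refine forall_congr' fun q => imp_congr Iff.rfl <| imp_congr Iff.rfl <| exists_congr fun n => ?_
  constructor
  · rintro ⟨A, m, hA⟩
    obtain ⟨P, hP⟩ := hA.1.exists_isCode hA.2.1
    exact ⟨P, (h.isNonstdFactorization_iff hP).1 hA⟩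
  · rintro ⟨P, hP⟩
    obtain ⟨A, m, hA⟩ := isNonstdTuple_iff.1 hP.1
    exact ⟨A, m, (h.isNonstdFactorization_iff hA).2 hP⟩

theorem IsPolyRing.eqUpToPermAndUnitsRel_iff (h : IsPolyRing mon)
    {F : Type u} [Field F] (T : TupleEnum F)
    {n m : NumSort M} {P : Idx n → NPoly M} {A : ListSort M} {a : NumSort M} (hP : IsCode P A a)
    {S : Idx m → NPoly M} {B : ListSort M} {b : NumSort M} (hS : IsCode S B b) :
    EqUpToPermAndUnitsRel mon T n A a m B b ↔ EqUpToPermAndUnits T P S := by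
  simp only [EqUpToPermAndUnitsRel, EqUpToPermAndUnits, h.oneRel_iff, h.mulRel_iff,
    exists_eq_left]
  refine and_congr Iff.rfl ?_
  constructor
  · rintro ⟨c, C, d, ⟨hL, hσ, hinj, hsurj⟩, hC, hU, h1, hmul⟩
    obtain ⟨U, hCU⟩ := hC.exists_isCode hU
    -- The number `c` gives only the graph of a permutation: totality yields the map itself, and the
    -- other clauses make it bijective.
    choose f hf hTf using hσ
    let σ : Idx n → Idx m := fun i => ⟨f i.1 i.2, hf i.1 i.2⟩
    have hT : ∀ i : Idx n, T.T.Realize (M := M) ![(c : M), ((σ i).1 : M), (i.1 : M)] :=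
      fun i => (hTf i.1 i.2 _).2 rfl
    have hbij : Function.Bijective σ := by
      refine ⟨fun i j e => Subtype.ext (hinj i.1 j.1 _ i.2 j.2 (hT i) ?_), fun x => ?_⟩
      · rw [e]
        exact hT j
      · obtain ⟨i, hi, k⟩ := hsurj x.1 x.2
        exact ⟨⟨i, hi⟩, Subtype.ext ((hTf i hi _).1 k).symm⟩
    refine ⟨Equiv.ofBijective σ hbij, U, ⟨c, hL, fun i x => hTf i.1 i.2 x⟩,
      isNonstdTuple_iff.2 ⟨C, d, hCU⟩, ?_, (h.prodRel_iff hCU).1 h1, fun i => ?_⟩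
    · simpa only [h.unitRel_iff] using hCU.forall_iff.1 hU
    · exact (hmul i.1 _ i.2 (hT i) _ _ _ (hP.2 i) (hCU.2 i) (hS.2 (σ i))).symm
  · rintro ⟨σ, U, ⟨c, hL, hσ⟩, hC, hU, h1, hmul⟩
    obtain ⟨C, d, hCU⟩ := isNonstdTuple_iff.1 hC
    refine ⟨c, C, d, ⟨hL, fun i hi => ⟨_, (σ ⟨i, hi⟩).2, hσ ⟨i, hi⟩⟩,
      fun i j x hi hj k l => ?_, fun x hx => ⟨_, (σ.symm ⟨x, hx⟩).2, ?_⟩⟩, hCU.1, ?_,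
      (h.prodRel_iff hCU).2 h1, fun i x hi k p u s hp hu hs => ?_⟩
    · have := ((hσ ⟨i, hi⟩ x).1 k).symm.trans ((hσ ⟨j, hj⟩ x).1 l)
      exact congrArg Subtype.val (σ.injective (Subtype.ext this))
    · rw [hσ, Equiv.apply_symm_apply]
    · rw [hCU.forall_iff]
      simpa only [h.unitRel_iff] using hU
    · have := (hσ ⟨i, hi⟩ x).1 k
      subst this
      rw [(hP.blk_iff ⟨i, hi⟩).1 hp, (hCU.blk_iff ⟨i, hi⟩).1 hu, (hS.blk_iff _).1 hs, hmul]

theorem IsPolyRing.uniqueFactorizationRel_iff (h : IsPolyRing mon)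
    {F : Type u} [Field F] (T : TupleEnum F) :
    UniqueFactorizationRel mon T ↔ ∀ (q : NPoly M) (n m : NumSort M)
      (P : Idx n → NPoly M) (S : Idx m → NPoly M),
      IsNonstdFactorization P q → IsNonstdFactorization S q → EqUpToPermAndUnits T P S := by
  refine forall_congr' fun q => forall_congr' fun n => forall_congr' fun m => ?_
  constructor
  · intro k P S hP hS
    obtain ⟨A, a, hA⟩ := isNonstdTuple_iff.1 hP.1
    obtain ⟨B, b, hB⟩ := isNonstdTuple_iff.1 hS.1
    exact (h.eqUpToPermAndUnitsRel_iff T hA hB).1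
      (k A a B b ((h.isNonstdFactorization_iff hA).2 hP) ((h.isNonstdFactorization_iff hB).2 hS))
  · intro k A a B b hA hB
    obtain ⟨P, hP⟩ := hA.1.exists_isCode hA.2.1
    obtain ⟨S, hS⟩ := hB.1.exists_isCode hB.2.1
    exact (h.eqUpToPermAndUnitsRel_iff T hP hS).2
      (k P S ((h.isNonstdFactorization_iff hP).1 hA) ((h.isNonstdFactorization_iff hS).1 hB))

end Translation

/-! ### Joint definability and transfer of the coded factorization statements -/

section JointFactorization

variable {M : Type v} {N : Type u} [listLang.Structure M] [listLang.Structure N]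
  {S S' : Type*} [I : Interp listLang M N S S']
  {n m i : S → NumSort M} {n' m' i' : S' → NumSort N}
  [JMap listLang M N n n'] [JMap listLang M N m m'] [JMap listLang M N i i']
  {A : S → ListSort M} {A' : S' → ListSort N} [JMap listLang M N A A']
  {p : S → NPoly M} {p' : S' → NPoly N} [JMap listLang M N p p']
  (mon : NumSort M → NumSort M → NumSort M → Prop)
  (mon' : NumSort N → NumSort N → NumSort N → Prop) [hmon : JMon mon mon']

set_option synthInstance.maxHeartbeats 0
set_option synthInstance.maxSize 100000
set_option maxHeartbeats 0

instance : JDef listLang M N (fun s => InIdx (n s) (i s)) (fun s => InIdx (n' s) (i' s)) := by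
  unfold InIdx; infer_instance

instance : JDef listLang M N (fun s => HasBlocks (n s) (A s) (m s))
    (fun s => HasBlocks (n' s) (A' s) (m' s)) := by
  have : JDef listLang M N (fun p : NumSort M × ListSort M × NumSort M => HasBlocks p.1 p.2.1 p.2.2)
      (fun p : NumSort N × ListSort N × NumSort N => HasBlocks p.1 p.2.1 p.2.2) := by
    unfold HasBlocks; infer_instance
  exact this.comp₃ _ _ _ _ _ _

instance : JDef listLang M N (fun s => Blk (A s) (m s) (i s) (p s))
    (fun s => Blk (A' s) (m' s) (i' s) (p' s)) := by
  have : JDef listLang M N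
      (fun p : ListSort M × NumSort M × NumSort M × NPoly M => Blk p.1 p.2.1 p.2.2.1 p.2.2.2)
      (fun p : ListSort N × NumSort N × NumSort N × NPoly N => Blk p.1 p.2.1 p.2.2.1 p.2.2.2) := by
    unfold Blk; infer_instance
  exact this.comp₄ _ _ _ _ _ _ _ _

instance : JDef listLang M N (fun s => OneRel mon (p s)) (fun s => OneRel mon' (p' s)) := by
  have : JDef listLang M N (OneRel mon) (OneRel mon') := by
    unfold OneRel; infer_instance
  exact this.comp _ _

instance JDef.unitRel : JDef listLang M N (UnitRel mon) (UnitRel mon') := by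
  unfold UnitRel; infer_instance

instance : JDef listLang M N (fun s => UnitRel mon (p s)) (fun s => UnitRel mon' (p' s)) :=
  (JDef.unitRel mon mon').comp _ _

instance : JDef listLang M N (fun s => IrrRel mon (p s)) (fun s => IrrRel mon' (p' s)) := by
  have : JDef listLang M N (IrrRel mon) (IrrRel mon') := by
    unfold IrrRel; infer_instance
  exact this.comp _ _

instance : JDef listLang M N (fun s => ProdRel mon (n s) (A s) (m s) (p s))
    (fun s => ProdRel mon' (n' s) (A' s) (m' s) (p' s)) := by
  have : JDef listLang M N
      (fun p : NumSort M × ListSort M × NumSort M × NPoly M =>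
        ProdRel mon p.1 p.2.1 p.2.2.1 p.2.2.2)
      (fun p : NumSort N × ListSort N × NumSort N × NPoly N =>
        ProdRel mon' p.1 p.2.1 p.2.2.1 p.2.2.2) := by
    unfold ProdRel; infer_instance
  exact this.comp₄ _ _ _ _ _ _ _ _

theorem existsFactorizationRel_iff (h : listLang.ElementarilyEquivalent M N) :
    ExistsFactorizationRel mon ↔ ExistsFactorizationRel mon' := by
  refine JDef.transfer h ?_
  unfold ExistsFactorizationRel
  infer_instance

theorem uniqueFactorizationRel_iff (h : listLang.ElementarilyEquivalent M N) {F : Type*} [Field F]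
    (T : TupleEnum F) : UniqueFactorizationRel mon T ↔ UniqueFactorizationRel mon' T := by
  refine JDef.transfer h ?_
  unfold UniqueFactorizationRel EqUpToPermAndUnitsRel
  infer_instance

end JointFactorization

/-! ## The standard model -/

namespace Standard

/-! ### Elements, atomic relations and finite sums in the standard model -/

section Atoms

variable {F : Type u} [Field F]

/-- The numbers of the standard model. -/
def num (n : ℕ) : NumSort (ListSuper F) := ⟨.num n, n, rfl⟩

/-- The field elements of the standard model. -/
def fld (a : F) : FieldSort (ListSuper F) := ⟨.fld a, a, rfl⟩

/-- The lists of the standard model. -/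
def lst (s : List F) (hs : s ≠ []) : ListSort (ListSuper F) := ⟨.lst s hs, s, hs, rfl⟩

theorem exists_eq_num (x : NumSort (ListSuper F)) : ∃ n, x = num n :=
  let ⟨n, h⟩ := x.2; ⟨n, Subtype.ext h⟩

theorem exists_eq_fld (x : FieldSort (ListSuper F)) : ∃ a, x = fld a :=
  let ⟨a, h⟩ := x.2; ⟨a, Subtype.ext h⟩

theorem exists_eq_lst (x : ListSort (ListSuper F)) : ∃ s hs, x = lst s hs :=
  let ⟨s, hs, h⟩ := x.2; ⟨s, hs, Subtype.ext h⟩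

theorem forall_num {φ : NumSort (ListSuper F) → Prop} : (∀ x, φ x) ↔ ∀ n, φ (num n) :=
  ⟨fun h n => h _, fun h x => by obtain ⟨n, rfl⟩ := exists_eq_num x; exact h n⟩

theorem exists_num {φ : NumSort (ListSuper F) → Prop} : (∃ x, φ x) ↔ ∃ n, φ (num n) :=
  ⟨fun ⟨x, h⟩ => by obtain ⟨n, rfl⟩ := exists_eq_num x; exact ⟨n, h⟩, fun ⟨n, h⟩ => ⟨_, h⟩⟩

theorem forall_fld {φ : FieldSort (ListSuper F) → Prop} : (∀ x, φ x) ↔ ∀ a, φ (fld a) :=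
  ⟨fun h n => h _, fun h x => by obtain ⟨n, rfl⟩ := exists_eq_fld x; exact h n⟩

theorem exists_fld {φ : FieldSort (ListSuper F) → Prop} : (∃ x, φ x) ↔ ∃ a, φ (fld a) :=
  ⟨fun ⟨x, h⟩ => by obtain ⟨n, rfl⟩ := exists_eq_fld x; exact ⟨n, h⟩, fun ⟨n, h⟩ => ⟨_, h⟩⟩

theorem exists_lst {φ : ListSort (ListSuper F) → Prop} : (∃ x, φ x) ↔ ∃ s hs, φ (lst s hs) :=
  ⟨fun ⟨x, h⟩ => by obtain ⟨s, hs, rfl⟩ := exists_eq_lst x; exact ⟨s, hs, h⟩,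
    fun ⟨s, hs, h⟩ => ⟨_, h⟩⟩

theorem num_inj {m n : ℕ} : (num m : NumSort (ListSuper F)) = num n ↔ m = n := by
  simp [num]

theorem coe_num_inj {m n : ℕ} :
    ((num m : NumSort (ListSuper F)) : ListSuper F) = (num n : NumSort (ListSuper F)) ↔ m = n := by
  simp [num]

theorem fld_eq_zeroF {a : F} : ((fld a : FieldSort (ListSuper F)) : ListSuper F) =
    zeroF (ListSuper F) ↔ a = 0 :=
  ⟨fun h => ListSuper.fld.inj h, fun h => congrArg ListSuper.fld h⟩

theorem oneN_eq : oneN (ListSuper F) = (num 1 : NumSort (ListSuper F)) := rfl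

theorem addN_iff {m n k : ℕ} : AddN ((num m : NumSort (ListSuper F)) : ListSuper F)
    (num n : NumSort (ListSuper F)) (num k : NumSort (ListSuper F)) ↔ m + n = k :=
  ⟨by rintro ⟨a, b, ha, hb, hc⟩; cases ha; cases hb; cases hc; rfl,
    by rintro rfl; exact ⟨_, _, rfl, rfl, rfl⟩⟩

theorem mulN_iff {m n k : ℕ} : MulN ((num m : NumSort (ListSuper F)) : ListSuper F)
    (num n : NumSort (ListSuper F)) (num k : NumSort (ListSuper F)) ↔ m * n = k :=
  ⟨by rintro ⟨a, b, ha, hb, hc⟩; cases ha; cases hb; cases hc; rfl,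
    by rintro rfl; exact ⟨_, _, rfl, rfl, rfl⟩⟩

theorem addF_iff {a b c : F} : AddF ((fld a : FieldSort (ListSuper F)) : ListSuper F)
    (fld b : FieldSort (ListSuper F)) (fld c : FieldSort (ListSuper F)) ↔ a + b = c :=
  ⟨by rintro ⟨a, b, ha, hb, hc⟩; cases ha; cases hb; cases hc; rfl,
    by rintro rfl; exact ⟨_, _, rfl, rfl, rfl⟩⟩

theorem mulF_iff {a b c : F} : MulF ((fld a : FieldSort (ListSuper F)) : ListSuper F)
    (fld b : FieldSort (ListSuper F)) (fld c : FieldSort (ListSuper F)) ↔ a * b = c :=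
  ⟨by rintro ⟨a, b, ha, hb, hc⟩; cases ha; cases hb; cases hc; rfl,
    by rintro rfl; exact ⟨_, _, rfl, rfl, rfl⟩⟩

theorem entry_iff {s : List F} {hs : s ≠ []} {a : F} {i : ℕ} :
    Entry ((lst s hs : ListSort (ListSuper F)) : ListSuper F) (fld a : FieldSort (ListSuper F))
      (num i : NumSort (ListSuper F)) ↔ ∃ j, i = j + 1 ∧ s[j]? = some a :=
  ⟨by rintro ⟨s, hs, a, i, h₁, h₂, h₃, h⟩; cases h₁; cases h₂; cases h₃; exact ⟨i, rfl, h⟩,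
    by rintro ⟨j, rfl, h⟩; exact ⟨s, hs, a, j, rfl, rfl, rfl, h⟩⟩

theorem len_iff {s : List F} {hs : s ≠ []} {n : ℕ} :
    Len ((lst s hs : ListSort (ListSuper F)) : ListSuper F) (num n : NumSort (ListSuper F)) ↔
      s.length = n :=
  ⟨by rintro ⟨s, hs, h₁, h₂⟩; cases h₁; cases h₂; rfl,
    by rintro rfl; exact ⟨s, hs, rfl, rfl⟩⟩

theorem le_iff {m n : ℕ} : Le ((num m : NumSort (ListSuper F)) : ListSuper F)
    (num n : NumSort (ListSuper F)) ↔ m ≤ n := by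
  simp only [Le, exists_num, addN_iff]
  exact ⟨fun ⟨d, h⟩ => by omega, fun h => ⟨n - m, by omega⟩⟩

theorem lt_iff {m n : ℕ} : Lt ((num m : NumSort (ListSuper F)) : ListSuper F)
    (num n : NumSort (ListSuper F)) ↔ m < n := by
  simp only [Lt, exists_num, oneN_eq, addN_iff, le_iff, exists_eq_left', Nat.succ_le_iff]

/-- Coefficients are indexed from `0` and entries from `1`; the two shifts cancel, and the second
case of `Coef` is the default value of `getD`. -/
theorem coef_iff {s : List F} {hs : s ≠ []} {j : ℕ} {a : F} :
    Coef (lst s hs : ListSort (ListSuper F)) (num j) (fld a) ↔ s.getD j 0 = a := by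
  simp only [Coef, exists_num, exists_fld, oneN_eq, addN_iff, entry_iff, exists_eq_left',
    fld_eq_zeroF, Nat.add_right_cancel_iff, List.getD_eq_getElem?_getD]
  cases h : s[j]? <;> simp [h, eq_comm]

theorem isSum_iff {d : List F} {hd : d ≠ []} {c : F} :
    IsSum (lst d hd : ListSort (ListSuper F)) (fld c) ↔ d.sum = c := by
  simp only [IsSum, exists_num, exists_lst, forall_num, forall_fld, oneN_eq, addN_iff, entry_iff,
    len_iff, addF_iff]
  constructor
  · rintro ⟨r, hr, n, rfl, hn, h₁, h₂, i, hi, hc⟩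
    -- By induction along the recursion for partial sums, the entry of `r` at the zero-based
    -- position `i` is the sum of the first `i + 1` entries of `d`.
    have key : ∀ i x, r[i]? = some x → (d.take (i + 1)).sum = x := by
      intro i
      induction i with
      | zero =>
        intro x hx
        obtain ⟨j, hj, hd'⟩ := (h₁ x).1 ⟨0, rfl, hx⟩
        obtain rfl : j = 0 := by omega
        cases d with
        | nil => exact absurd rfl hd
        | cons y d => simpa using hd'
      | succ i ih =>
        intro x hx
        have hi : i + 1 < d.length := hn ▸ (List.getElem?_eq_some_iff.1 hx).1
        have hr' : i < r.length := by omega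
        have := h₂ (i + 1) (i + 2) r[i] d[i + 1] x rfl ⟨i, rfl, List.getElem?_eq_getElem hr'⟩
          ⟨i + 1, rfl, List.getElem?_eq_getElem hi⟩ ⟨i + 1, rfl, hx⟩
        rw [List.sum_take_succ _ _ hi, ih _ (List.getElem?_eq_getElem hr'), this]
    rw [← key i c hc, ← hi, List.take_length]
  · rintro rfl
    have hd' := List.length_pos_iff.2 hd
    have key : ∀ i, i < d.length →
        ((List.range d.length).map fun i => (d.take (i + 1)).sum)[i]? =
          some (d.take (i + 1)).sum := by
      intro i hi
      simp [hi]
    -- The witness is the list of all partial sums of `d`.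
    refine ⟨(List.range d.length).map fun i => (d.take (i + 1)).sum, by simpa using hd, d.length,
      rfl, by simp, fun a => ?_, ?_, d.length - 1, by omega, ?_⟩
    · cases d with
      | nil => exact absurd rfl hd
      | cons y d => simp
    · rintro _ _ x y z rfl ⟨i, hi, hx⟩ ⟨j, hj, hy⟩ ⟨l, hl, hz⟩
      obtain ⟨hj', rfl⟩ := List.getElem?_eq_some_iff.1 hy
      obtain rfl : j = i + 1 := by omega
      obtain rfl : l = i + 1 := by omega
      rw [key _ (by omega), Option.some_inj] at hx hz
      rw [← hx, ← hz, List.sum_take_succ _ _ hj']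
    · rw [key _ (by omega), Nat.sub_add_cancel hd', List.take_length]

end Atoms

end Standard

namespace Standard

/-! ### The ring of polynomials over the standard model -/

section Ring

variable {F : Type u} [Field F] {k : ℕ} (e : ℕ ≃ (Fin k →₀ ℕ))

/-- The polynomial with a given list of coefficients. -/
noncomputable def toPoly (s : List F) : MvPolynomial (Fin k) F :=
  ∑ i ∈ Finset.range s.length, MvPolynomial.monomial (e i) (s.getD i 0)

theorem coeff_toPoly (s : List F) (j : ℕ) : (toPoly e s).coeff (e j) = s.getD j 0 := by
  classical
  simp only [toPoly, MvPolynomial.coeff_sum, MvPolynomial.coeff_monomial, e.injective.eq_iff,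
    Finset.sum_ite_eq', Finset.mem_range]
  split_ifs with h
  · rfl
  · rw [List.getD_eq_default _ _ (not_lt.1 h)]

theorem toPoly_ext {p q : MvPolynomial (Fin k) F} (h : ∀ j, p.coeff (e j) = q.coeff (e j)) :
    p = q :=
  MvPolynomial.ext _ _ fun m => by simpa using h (e.symm m)

theorem exists_toPoly (p : MvPolynomial (Fin k) F) : ∃ s, s ≠ [] ∧ toPoly e s = p := by
  -- The list reaches the largest index of a monomial in the support; the `+ 1` includes that index
  -- and keeps the list nonempty when `p = 0`.
  refine ⟨(List.range (p.support.sup e.symm + 1)).map fun i => p.coeff (e i), by simp,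
    toPoly_ext e fun j => ?_⟩
  rw [coeff_toPoly, List.getD_eq_getElem?_getD, List.getElem?_map]
  by_cases h : j < p.support.sup e.symm + 1
  · simp [List.getElem?_range h]
  · rw [List.getElem?_eq_none (by simpa using h)]
    by_contra h'
    have := Finset.le_sup (f := e.symm) (MvPolynomial.mem_support_iff.2 (Ne.symm h'))
    rw [e.symm_apply_apply] at this
    omega

theorem tailEq_iff {s t : List F} {hs : s ≠ []} {ht : t ≠ []} :
    TailEq (lst s hs : ListSort (ListSuper F)) (lst t ht) ↔ toPoly e s = toPoly e t := by
  simp only [TailEq, forall_num, forall_fld, coef_iff]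
  constructor
  · exact fun h => toPoly_ext e fun j => by rw [coeff_toPoly, coeff_toPoly]; exact (h j _).2 rfl
  · intro h j a
    rw [← coeff_toPoly e, ← coeff_toPoly e, h]

theorem listAdd_iff {a b c : List F} {ha : a ≠ []} {hb : b ≠ []} {hc : c ≠ []} :
    ListAdd (lst a ha : ListSort (ListSuper F)) (lst b hb) (lst c hc) ↔
      toPoly e a + toPoly e b = toPoly e c := by
  simp only [ListAdd, forall_num, exists_fld, coef_iff, addF_iff, ← coeff_toPoly e,
    exists_and_left, exists_eq_left']
  exact ⟨fun h => toPoly_ext e fun j => by rw [MvPolynomial.coeff_add, h], fun h j => by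
    rw [← h, MvPolynomial.coeff_add]⟩

/-- The contribution of the `i`-th coefficient of `a` to the coefficient of `a * b` at `l`. -/
noncomputable def mulTerm (a b : List F) (l i : ℕ) : F :=
  open Classical in if e i ≤ e l then a.getD i 0 * (toPoly e b).coeff (e l - e i) else 0

/-- Only the first factor is expanded into monomials, to match `ListMul`, where the summands are
indexed by the entries of `a`. -/
theorem coeff_toPoly_mul (a b : List F) (l : ℕ) :
    (toPoly e a * toPoly e b).coeff (e l) = ∑ i ∈ Finset.range a.length, mulTerm e a b l i := by
  classical
  conv_lhs => rw [toPoly, Finset.sum_mul, MvPolynomial.coeff_sum]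
  refine Finset.sum_congr rfl fun i _ => ?_
  rw [MvPolynomial.coeff_monomial_mul', mulTerm]

/-- As `e` is a bijection onto all exponent vectors, a cofactor `j` exists exactly when `e i ≤ e l`,
and it is then the unique index of `e l - e i`. -/
theorem eq_mulTerm_iff {a b : List F} {l i : ℕ} {x : F} :
    ((∃ j, e i + e j = e l ∧ a.getD i 0 * b.getD j 0 = x) ∨ (¬ ∃ j, e i + e j = e l) ∧ x = 0) ↔
      x = mulTerm e a b l i := by
  by_cases h : e i ≤ e l
  · have key : ∀ j, e i + e j = e l ↔ j = e.symm (e l - e i) := fun j => by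
      rw [Equiv.eq_symm_apply, eq_tsub_iff_add_eq_of_le h, add_comm]
    simp only [key, mulTerm, if_pos h, exists_eq_left, exists_eq, not_true, false_and, or_false,
      ← coeff_toPoly e b, e.apply_symm_apply, eq_comm]
  · have key : ∀ j, ¬ e i + e j = e l := fun j hj => h (hj ▸ le_self_add)
    simp only [key, mulTerm, if_neg h, false_and, exists_false, not_false_iff, true_and, false_or]

variable {mon : NumSort (ListSuper F) → NumSort (ListSuper F) → NumSort (ListSuper F) → Prop}

theorem sum_eq_sum_range_getD (d : List F) : d.sum = ∑ i ∈ Finset.range d.length, d.getD i 0 := by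
  rw [Finset.sum_range, ← Fin.sum_univ_getElem]
  simp

theorem listMul_iff (hmon : ∀ i j l, mon (num i) (num j) (num l) ↔ e i + e j = e l)
    {a b c : List F} {ha : a ≠ []} {hb : b ≠ []} {hc : c ≠ []} :
    ListMul mon (lst a ha : ListSort (ListSuper F)) (lst b hb) (lst c hc) ↔
      toPoly e a * toPoly e b = toPoly e c := by
  simp only [ListMul, forall_num, exists_num, exists_fld, exists_lst, coef_iff, mulF_iff, lt_iff,
    len_iff, isSum_iff, hmon, fld_eq_zeroF, exists_and_left, exists_eq_left',
    eq_mulTerm_iff]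
  have key : (toPoly e a * toPoly e b = toPoly e c) ↔
      ∀ l, ∑ i ∈ Finset.range a.length, mulTerm e a b l i = c.getD l 0 := by
    simp only [← coeff_toPoly_mul, ← coeff_toPoly e c]
    exact ⟨fun h l => by rw [h], toPoly_ext e⟩
  rw [key]
  refine forall_congr' fun l => ?_
  constructor
  · rintro ⟨d, hd, h, _, h'⟩
    rw [h', sum_eq_sum_range_getD, hd]
    exact Finset.sum_congr rfl fun i hi => (h i (Finset.mem_range.1 hi)).symm
  -- The required tuple of summands is the list of all `mulTerm e a b l i` with `i < a.length`.
  · intro h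
    have hd : ∀ i < a.length, ((List.range a.length).map (mulTerm e a b l)).getD i 0 =
        mulTerm e a b l i := fun i hi => by
      rw [List.getD_eq_getElem?_getD, List.getElem?_map, List.getElem?_range hi]
      rfl
    refine ⟨(List.range a.length).map (mulTerm e a b l), by simp, hd, by simpa using ha, ?_⟩
    rw [← h, sum_eq_sum_range_getD, List.length_map, List.length_range]
    exact Finset.sum_congr rfl fun i hi => (hd i (Finset.mem_range.1 hi)).symm

/-- The entries of a list of the standard model. -/
def entries (s : ListSort (ListSuper F)) : List F :=
  match s.1 with
  | .lst s _ => s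
  -- This value is never taken, because the argument lies in the list sort.
  | _ => []

/-- The polynomial over `F` that a polynomial over the standard model stands for. -/
noncomputable def NPoly.toPoly : NPoly (ListSuper F) → MvPolynomial (Fin k) F :=
  Quot.lift (fun s => Standard.toPoly e (entries s)) fun s t h => by
    obtain ⟨s, hs, rfl⟩ := exists_eq_lst s
    obtain ⟨t, ht, rfl⟩ := exists_eq_lst t
    exact (tailEq_iff e).1 h

theorem NPoly.exists_mk_lst (p : NPoly (ListSuper F)) : ∃ s hs, p = NPoly.mk (lst s hs) := by
  obtain ⟨s, rfl⟩ := p.exists_mk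
  obtain ⟨s, hs, rfl⟩ := exists_eq_lst s
  exact ⟨s, hs, rfl⟩

theorem NPoly.toPoly_bijective :
    Function.Bijective (NPoly.toPoly e : NPoly (ListSuper F) → MvPolynomial (Fin k) F) := by
  constructor
  · intro p q h
    obtain ⟨s, hs, rfl⟩ := NPoly.exists_mk_lst p
    obtain ⟨t, ht, rfl⟩ := NPoly.exists_mk_lst q
    exact NPoly.mk_eq_mk.2 ((tailEq_iff e).2 h)
  · intro p
    obtain ⟨s, hs, rfl⟩ := exists_toPoly e p
    exact ⟨NPoly.mk (lst s hs), rfl⟩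

/-- A relation on lists that depends only on the represented polynomials holds for some
representatives as soon as it holds for any. -/
theorem exists_mk_lst_iff {p q r : NPoly (ListSuper F)}
    {φ : ListSort (ListSuper F) → ListSort (ListSuper F) → ListSort (ListSuper F) → Prop}
    {ψ : MvPolynomial (Fin k) F → MvPolynomial (Fin k) F → MvPolynomial (Fin k) F → Prop}
    (h : ∀ a b c ha hb hc, φ (lst a ha) (lst b hb) (lst c hc) ↔
      ψ (toPoly e a) (toPoly e b) (toPoly e c)) :
    (∃ a b c, NPoly.mk a = p ∧ NPoly.mk b = q ∧ NPoly.mk c = r ∧ φ a b c) ↔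
      ψ (NPoly.toPoly e p) (NPoly.toPoly e q) (NPoly.toPoly e r) := by
  constructor
  · rintro ⟨a, b, c, rfl, rfl, rfl, k⟩
    obtain ⟨a, ha, rfl⟩ := exists_eq_lst a
    obtain ⟨b, hb, rfl⟩ := exists_eq_lst b
    obtain ⟨c, hc, rfl⟩ := exists_eq_lst c
    exact (h _ _ _ _ _ _).1 k
  · intro k
    obtain ⟨a, ha, rfl⟩ := NPoly.exists_mk_lst p
    obtain ⟨b, hb, rfl⟩ := NPoly.exists_mk_lst q
    obtain ⟨c, hc, rfl⟩ := NPoly.exists_mk_lst r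
    exact ⟨_, _, _, rfl, rfl, rfl, (h _ _ _ _ _ _).2 k⟩

/-- The nonstandard polynomials over the standard model form a unique factorization domain. -/
theorem exists_isPolyRing (hmon : ∀ i j l, mon (num i) (num j) (num l) ↔ e i + e j = e l) :
    ∃ _ : CommRing (NPoly (ListSuper F)), IsPolyRing mon ∧ IsDomain (NPoly (ListSuper F)) ∧
      UniqueFactorizationMonoid (NPoly (ListSuper F)) := by
  let φ := Equiv.ofBijective _ (NPoly.toPoly_bijective (F := F) e)
  -- The ring structure is transported from `MvPolynomial (Fin k) F`, so being a domain with unique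
  -- factorization comes along with it.
  let inst : CommRing (NPoly (ListSuper F)) := φ.commRing
  refine ⟨inst, ⟨fun p q r => ?_, fun p q r => ?_⟩, φ.ringEquiv.toMulEquiv.isDomain _,
    φ.ringEquiv.symm.toMulEquiv.uniqueFactorizationMonoid inferInstance⟩
  · exact φ.symm_apply_eq.trans (exists_mk_lst_iff e (ψ := fun x y z => x + y = z)
      fun a b c ha hb hc => listAdd_iff e).symm
  · exact φ.symm_apply_eq.trans (exists_mk_lst_iff e (ψ := fun x y z => x * y = z)
      fun a b c ha hb hc => listMul_iff e hmon).symm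

end Ring

end Standard

namespace Standard

/-! ### Tuples over the standard model -/

section Tuples

variable {F : Type u} [Field F] {n m : ℕ}

theorem mem_idx {i : ℕ} : (Le (oneN (ListSuper F)) (num i : NumSort (ListSuper F)) ∧
    Le ((num i : NumSort (ListSuper F)) : ListSuper F) (num n : NumSort (ListSuper F))) ↔
      1 ≤ i ∧ i ≤ n := by
  rw [oneN_eq, le_iff, le_iff]

/-- The elements of the interval `[1, n]` of the standard model. -/
noncomputable def idxEquiv : Fin n ≃ Idx (num n : NumSort (ListSuper F)) :=
  Equiv.ofBijective (fun i => ⟨num (i + 1), mem_idx.2 ⟨by omega, by omega⟩⟩) <| by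
    constructor
    · intro i j h
      have := num_inj.1 (congrArg Subtype.val h)
      omega
    · rintro ⟨x, hx⟩
      obtain ⟨i, rfl⟩ := exists_eq_num x
      have := mem_idx.1 hx
      exact ⟨⟨i - 1, by omega⟩, Subtype.ext (congrArg num (by simp; omega))⟩

theorem idxEquiv_val (i : Fin n) :
    (idxEquiv i : Idx (num n : NumSort (ListSuper F))).1 = num (i + 1) := rfl

/-- The position `q = i * m + j` with `j < m` has quotient `i` and remainder `j` modulo `m`. -/
theorem getD_blocks {m : ℕ} (n : ℕ) (hm : 0 < m) (f : ℕ → List F) {i j : ℕ} (hi : i < n)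
    (hj : j < m) :
    ((List.range (n * m)).map fun q => (f (q / m)).getD (q % m) 0).getD (i * m + j) 0 =
      (f i).getD j 0 := by
  have h : i * m + j < n * m := calc
    i * m + j < i * m + m := by omega
    _ = (i + 1) * m := by ring
    _ ≤ n * m := Nat.mul_le_mul_right _ hi
  rw [List.getD_eq_getElem?_getD, List.getElem?_map, List.getElem?_range h, Option.map_some,
    Option.getD_some, mul_comm, Nat.mul_add_div hm, Nat.div_eq_of_lt hj, Nat.mul_add_mod,
    Nat.mod_eq_of_lt hj, add_zero]

theorem isNonstdTuple (hn : 1 ≤ n) (P : Idx (num n : NumSort (ListSuper F)) → NPoly (ListSuper F)) :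
    IsNonstdTuple P := by
  choose s hs hP using fun i : Fin n => NPoly.exists_mk_lst (P (idxEquiv i))
  let f : ℕ → List F := fun i => if h : i < n then s ⟨i, h⟩ else []
  -- The block length exceeds the lengths of all coefficient lists, so no coefficient is cut off; it
  -- is positive, so with `1 ≤ n` the coding list is nonempty.
  let m := (Finset.univ.sup fun i => (s i).length) + 1
  have hf : ∀ i : Fin n, f i = s i := fun i => dif_pos i.2
  have hm : 0 < m := Nat.succ_pos _
  have hnm : n * m ≠ 0 := by positivity
  refine ⟨lst ((List.range (n * m)).map fun q => (f (q / m)).getD (q % m) 0) (by simpa using hnm),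
    num m, num (n * m), mulN_iff.2 rfl, len_iff.2 (by simp), ?_⟩
  rw [← idxEquiv.forall_congr_right]
  intro i
  refine ⟨lst (s i) (hs i), (hP i).symm, ?_⟩
  simp only [forall_num, forall_fld, exists_num, lt_iff, coef_iff, fld_eq_zeroF, oneN_eq,
    idxEquiv_val, addN_iff, mulN_iff, Nat.add_right_cancel_iff, exists_and_left, exists_eq_left,
    exists_eq_left']
  refine fun j a => ⟨fun hj => ?_, fun hj => ?_⟩
  · rw [getD_blocks n hm f i.2 hj, hf]
  · have : (s i).length ≤ j := by
      have := Finset.le_sup (f := fun i => (s i).length) (Finset.mem_univ i)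
      omega
    rw [List.getD_eq_default _ _ this, eq_comm]

theorem isNonstdNumTuple (T : TupleEnum F) (hn : 1 ≤ n)
    (σ : Idx (num n : NumSort (ListSuper F)) → Idx (num m : NumSort (ListSuper F))) :
    IsNonstdNumTuple T σ := by
  let τ : Fin n → Fin m := fun i => idxEquiv.symm (σ (idxEquiv i))
  have hτ : ∀ i, σ (idxEquiv i) = idxEquiv (τ i) := fun i => by simp [τ]
  -- `Fin` counts from `0` and the intervals from `1`, hence the shift of the values.
  let l : List ℕ := List.ofFn fun i => (τ i : ℕ) + 1
  have hl : l ≠ [] := List.ne_nil_of_length_pos (by simpa [l] using Nat.pos_of_ne_zero (by omega))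
  refine ⟨num (T.tuple.symm ⟨l, hl⟩), (T.L_spec _ _).2 (by simp [l]), ?_⟩
  rw [← idxEquiv.forall_congr_right]
  simp only [forall_num, idxEquiv_val, hτ, num_inj]
  intro i a
  refine (T.T_spec _ _ _).trans ?_
  simp [l, eq_comm]

variable [CommRing (NPoly (ListSuper F))]

theorem isNonstdProd_iff (hn : 1 ≤ n)
    {P : Idx (num n : NumSort (ListSuper F)) → NPoly (ListSuper F)} {q : NPoly (ListSuper F)} :
    IsNonstdProd P q ↔ ∏ i, P (idxEquiv i) = q := by
  -- Extending to all of `ℕ` allows induction over `Finset.range`; the value `1` outside the range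
  -- never enters the partial products used below.
  let f : ℕ → NPoly (ListSuper F) := fun i => if h : i < n then P (idxEquiv ⟨i, h⟩) else 1
  have hf : ∀ i : Fin n, f i = P (idxEquiv i) := fun i => dif_pos i.2
  have hprod : ∏ i, P (idxEquiv i) = ∏ i ∈ Finset.range n, f i := by
    rw [Finset.prod_range]
    exact Finset.prod_congr rfl fun i _ => (hf i).symm
  have hlast : ∃ i : Fin n, (i : ℕ) + 1 = n := ⟨⟨n - 1, by omega⟩, by simp; omega⟩
  simp only [IsNonstdProd, ← idxEquiv.forall_congr_right, ← idxEquiv.exists_congr_right,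
    idxEquiv_val, addN_iff, oneN_eq, coe_num_inj, num_inj, hprod]
  constructor
  · rintro ⟨S, -, h₁, h₂, i, hi, rfl⟩
    have key : ∀ j (hj : j < n), S (idxEquiv ⟨j, hj⟩) = ∏ i ∈ Finset.range (j + 1), f i := by
      intro j
      induction j with
      | zero =>
        intro hj
        rw [h₁ ⟨0, hj⟩ rfl, ← hf]
        simp
      | succ j ih =>
        intro hj
        rw [h₂ ⟨j, by omega⟩ ⟨j + 1, hj⟩ rfl, ih, Finset.prod_range_succ _ (j + 1), ← hf]
    rw [key i.1 i.2, hi]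
  · rintro rfl
    obtain ⟨i, hi⟩ := hlast
    refine ⟨fun x => ∏ i ∈ Finset.range ((idxEquiv.symm x : Fin n) + 1), f i,
      isNonstdTuple hn _, fun i hi => ?_, fun i j h => ?_, i, hi, ?_⟩
    · obtain rfl : i = ⟨0, hn⟩ := Fin.ext (Nat.succ.inj hi)
      beta_reduce
      rw [Equiv.symm_apply_apply, ← hf]
      simp
    · beta_reduce
      rw [Equiv.symm_apply_apply, Equiv.symm_apply_apply, ← h, Finset.prod_range_succ _ (i.1 + 1),
        Nat.succ.inj h, hf]
    · beta_reduce
      rw [Equiv.symm_apply_apply, hi]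

/-- The last entry of the tuple of partial products needs an index in `[1, n]`, which rules out the
empty interval. -/
theorem one_le_of_isNonstdProd
    {P : Idx (num n : NumSort (ListSuper F)) → NPoly (ListSuper F)} {q : NPoly (ListSuper F)}
    (h : IsNonstdProd P q) : 1 ≤ n := by
  obtain ⟨S, -, -, -, i, -⟩ := h
  have := (idxEquiv.symm i).2
  omega

end Tuples

end Standard

/-! ### Factorization over the standard model -/

section UniqueFactorization

/-- Equal multisets of values mean that `f` and `g` have fibres of the same size over every point;
bijections between the fibres glue together. -/
theorem exists_equiv_of_map_univ_eq {α β γ : Type*} [Fintype α] [Fintype β] {f : α → γ} {g : β → γ}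
    (h : (Finset.univ.val.map f : Multiset γ) = Finset.univ.val.map g) :
    ∃ σ : α ≃ β, ∀ a, g (σ a) = f a := by
  classical
  have key : ∀ c, Nonempty ({a // f a = c} ≃ {b // g b = c}) := fun c => by
    rw [← Fintype.card_eq, Fintype.card_subtype, Fintype.card_subtype]
    simpa [Multiset.count_map, Finset.card_def, Finset.filter_val, eq_comm] using
      congrArg (Multiset.count c) h
  exact ⟨Equiv.ofFiberEquiv fun c => (key c).some, Equiv.ofFiberEquiv_map _⟩

variable {R : Type*} [CommRing R] [UniqueFactorizationMonoid R]

theorem exists_irreducible_fin_prod {q : R} (h0 : q ≠ 0) (hu : ¬ IsUnit q) :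
    ∃ n, 1 ≤ n ∧ ∃ f : Fin n → R, (∀ i, Irreducible (f i)) ∧ ∏ i, f i = q := by
  obtain ⟨s, hs, hq, hne⟩ := (WfDvdMonoid.not_isUnit_iff_exists_factors_eq q h0).1 hu
  refine ⟨s.toList.length, ?_, fun i => s.toList[i], fun i => hs _ ?_, ?_⟩
  · rw [Multiset.length_toList]
    exact Multiset.card_pos.2 hne
  · exact Multiset.mem_toList.1 (List.getElem_mem _)
  · beta_reduce
    rw [← hq, ← Multiset.prod_toList, ← Fin.prod_univ_getElem]
    rfl

/-- In `Associates R` the two multisets of irreducible factors become equal, and this equality is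
realized by a bijection of the indices. The resulting units have product `1` because the nonzero
product of the `g i` can be cancelled. -/
theorem exists_perm_units_of_prod_eq [IsDomain R] {n m : ℕ} {f : Fin n → R} {g : Fin m → R}
    (hf : ∀ i, Irreducible (f i)) (hg : ∀ i, Irreducible (g i)) (h : ∏ i, f i = ∏ i, g i) :
    ∃ (_ : n = m) (σ : Fin n ≃ Fin m) (u : Fin n → R), (∀ i, IsUnit (u i)) ∧ ∏ i, u i = 1 ∧
      ∀ i, f i = u i * g (σ i) := by
  have hrel : Multiset.Rel Associated (Finset.univ.val.map f) (Finset.univ.val.map g) :=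
    UniqueFactorizationMonoid.factors_unique (by simpa using hf) (by simpa using hg)
      (by simpa [Finset.prod] using Associated.of_eq h)
  obtain rfl : n = m := by simpa using Multiset.card_eq_card_of_rel hrel
  rw [Associates.rel_associated_iff_map_eq_map, Multiset.map_map, Multiset.map_map] at hrel
  obtain ⟨σ, hσ⟩ := exists_equiv_of_map_univ_eq hrel
  have hassoc : ∀ i, ∃ u : R, IsUnit u ∧ f i = u * g (σ i) := fun i => by
    obtain ⟨u, hu⟩ := (Associates.mk_eq_mk_iff_associated.1 (hσ i))
    exact ⟨u, u.isUnit, by rw [← hu, mul_comm]⟩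
  choose u hu hfu using hassoc
  refine ⟨rfl, σ, u, hu, ?_, hfu⟩
  have hne : ∏ i, g i ≠ 0 := Finset.prod_ne_zero_iff.2 fun i _ => (hg i).ne_zero
  have hprod : ∏ i, f i = (∏ i, u i) * ∏ i, g i := by
    rw [Finset.prod_congr rfl fun i _ => hfu i, Finset.prod_mul_distrib, Equiv.prod_comp σ g]
  exact mul_right_cancel₀ hne (by rw [one_mul, ← hprod, h])

end UniqueFactorization

/-! ### Nonstandard factorizations over the standard model -/

namespace Standard

variable {F : Type u} [Field F] [CommRing (NPoly (ListSuper F))]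
  [UniqueFactorizationMonoid (NPoly (ListSuper F))]

theorem exists_isNonstdFactorization {q : NPoly (ListSuper F)} (h0 : q ≠ 0) (hu : ¬ IsUnit q) :
    ∃ (n : NumSort (ListSuper F)) (P : Idx n → NPoly (ListSuper F)),
      IsNonstdFactorization P q := by
  obtain ⟨n, hn, f, hf, hq⟩ := exists_irreducible_fin_prod h0 hu
  refine ⟨num n, fun i => f (idxEquiv.symm i), isNonstdTuple hn _, fun i => hf _, ?_⟩
  rw [isNonstdProd_iff hn, ← hq]
  simp

theorem eqUpToPermAndUnits [IsDomain (NPoly (ListSuper F))] (T : TupleEnum F)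
    {q : NPoly (ListSuper F)} {n m : NumSort (ListSuper F)}
    {P : Idx n → NPoly (ListSuper F)} {S : Idx m → NPoly (ListSuper F)}
    (hP : IsNonstdFactorization P q) (hS : IsNonstdFactorization S q) :
    EqUpToPermAndUnits T P S := by
  obtain ⟨n, rfl⟩ := exists_eq_num n
  obtain ⟨m, rfl⟩ := exists_eq_num m
  have hn := one_le_of_isNonstdProd hP.2.2
  have hm := one_le_of_isNonstdProd hS.2.2
  obtain ⟨hnm, σ, u, hu, hu1, hfu⟩ := exists_perm_units_of_prod_eq
    (fun i => hP.2.1 (idxEquiv i)) (fun i => hS.2.1 (idxEquiv i))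
    (((isNonstdProd_iff hn).1 hP.2.2).trans ((isNonstdProd_iff hm).1 hS.2.2).symm)
  refine ⟨congrArg num hnm, (idxEquiv.symm.trans σ).trans idxEquiv, fun i => u (idxEquiv.symm i),
    isNonstdNumTuple T hn _, isNonstdTuple hn _, fun i => hu _, ?_, fun i => ?_⟩
  · rw [isNonstdProd_iff hn, ← hu1]
    simp
  · simpa using hfu (idxEquiv.symm i)

end Standard

/-! ## The theorem -/

/-- The ring on `M` comes first, by transfer of the axioms. With it fixed, existence and uniqueness
are rewritten in terms of codes, transferred, and read back in the standard ring. The monomial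
relation matters only through joint definability and its standard meaning `he`, so one argument
serves both rings. -/
theorem exists_ring_with_unique_factorization {F : Type u} [Field F] {M : Type v}
    [listLang.Structure M] (hM : listLang.ElementarilyEquivalent M (ListSuper F)) {k : ℕ}
    (e : ℕ ≃ (Fin k →₀ ℕ)) (mon : NumSort M → NumSort M → NumSort M → Prop)
    (mon' : NumSort (ListSuper F) → NumSort (ListSuper F) → NumSort (ListSuper F) → Prop)
    [JMon mon mon']
    (he : ∀ i j l, mon' (Standard.num i) (Standard.num j) (Standard.num l) ↔ e i + e j = e l) :
    ∃ _ : CommRing (NPoly M), IsPolyRing mon ∧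
      (∀ q : NPoly M, q ≠ 0 → ¬ IsUnit q →
        ∃ (n : NumSort M) (P : Idx n → NPoly M), IsNonstdFactorization P q) ∧
      (∀ (T : TupleEnum F) (q : NPoly M) (n m : NumSort M) (P : Idx n → NPoly M)
        (S : Idx m → NPoly M), IsNonstdFactorization P q → IsNonstdFactorization S q →
          EqUpToPermAndUnits T P S) := by
  obtain ⟨_, hN, _, _⟩ := Standard.exists_isPolyRing e he
  obtain ⟨_, hR⟩ := (exists_isPolyRing_iff mon mon' hM).2 ⟨_, hN⟩
  refine ⟨_, hR, ?_, fun T => ?_⟩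
  · rw [← hR.existsFactorizationRel_iff, existsFactorizationRel_iff mon mon' hM,
      hN.existsFactorizationRel_iff]
    exact fun q => Standard.exists_isNonstdFactorization
  · rw [← hR.uniqueFactorizationRel_iff T, uniqueFactorizationRel_iff mon mon' hM T,
      hN.uniqueFactorizationRel_iff T]
    exact fun q n m P S => Standard.eqUpToPermAndUnits T

/-- In the standard model the graph formula leaves only one possible exponent vector for each index,
so the three existential quantifiers in `MonomialEnum.mon` disappear. -/
theorem mon_standard_iff {F : Type u} [Field F] {k : ℕ} (E : MonomialEnum F k) (i j l : ℕ) :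
    E.mon (ListSuper F) (Standard.num i) (Standard.num j) (Standard.num l) ↔
      E.monomial i + E.monomial j = E.monomial l := by
  have key : ∀ (n : ℕ) (e : Fin k → NumSort (ListSuper F)),
      E.graph.Realize (M := ListSuper F)
        (Fin.cons ((Standard.num n : NumSort (ListSuper F)) : ListSuper F)
          fun t => (e t : ListSuper F)) ↔
      e = fun t => Standard.num (E.monomial n t) := by
    intro n e
    choose f hf using fun t => Standard.exists_eq_num (e t)
    obtain rfl : e = fun t => Standard.num (f t) := funext hf
    refine (E.graph_spec n f).trans ?_
    simp only [funext_iff, Standard.num_inj, eq_comm]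
  simp only [MonomialEnum.mon, key, exists_and_left, exists_eq_left, Standard.addN_iff]
  exact funext_iff.symm

end NonstdPoly

theorem mainTheorem10 {F : Type u} [Field F] [Infinite F]
    {M : Type v} [listLang.Structure M]
    (hM : listLang.ElementarilyEquivalent M (ListSuper F)) :
    (∃ _ : CommRing (NonstdPoly.NPoly M),
      NonstdPoly.IsPolyRing (NonstdPoly.monSingle M) ∧
      (∀ q : NonstdPoly.NPoly M, q ≠ 0 → ¬ IsUnit q →
        ∃ (n : NonstdPoly.NumSort M) (P : NonstdPoly.Idx n → NonstdPoly.NPoly M),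
          NonstdPoly.IsNonstdFactorization P q) ∧
      (∀ (T : NonstdPoly.TupleEnum F) (q : NonstdPoly.NPoly M) (n m : NonstdPoly.NumSort M)
        (P : NonstdPoly.Idx n → NonstdPoly.NPoly M) (S : NonstdPoly.Idx m → NonstdPoly.NPoly M),
        NonstdPoly.IsNonstdFactorization P q → NonstdPoly.IsNonstdFactorization S q →
          NonstdPoly.EqUpToPermAndUnits T P S)) ∧
    (∀ (k : ℕ) (E : NonstdPoly.MonomialEnum F k), ∃ _ : CommRing (NonstdPoly.NPoly M),
      NonstdPoly.IsPolyRing (E.mon M) ∧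
      (∀ q : NonstdPoly.NPoly M, q ≠ 0 → ¬ IsUnit q →
        ∃ (n : NonstdPoly.NumSort M) (P : NonstdPoly.Idx n → NonstdPoly.NPoly M),
          NonstdPoly.IsNonstdFactorization P q) ∧
      (∀ (T : NonstdPoly.TupleEnum F) (q : NonstdPoly.NPoly M) (n m : NonstdPoly.NumSort M)
        (P : NonstdPoly.Idx n → NonstdPoly.NPoly M) (S : NonstdPoly.Idx m → NonstdPoly.NPoly M),
        NonstdPoly.IsNonstdFactorization P q → NonstdPoly.IsNonstdFactorization S q →
          NonstdPoly.EqUpToPermAndUnits T P S)) := by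
  constructor
  -- One variable is the case `Fin 1`, with each monomial indexed by its exponent.
  · refine NonstdPoly.exists_ring_with_unique_factorization hM
      ((Equiv.funUnique (Fin 1) ℕ).symm.trans Finsupp.equivFunOnFinite.symm)
      (NonstdPoly.monSingle M) (NonstdPoly.monSingle (ListSuper F)) fun i j l => ?_
    refine NonstdPoly.Standard.addN_iff.trans ?_
    simp [Finsupp.ext_iff]
  -- The case `k = 0` is vacuous: there is only one exponent vector, so no bijection with `ℕ`
  -- exists.
  · intro k E
    refine NonstdPoly.exists_ring_with_unique_factorization hM
      (E.monomial.trans Finsupp.equivFunOnFinite.symm)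
      (E.mon M) (E.mon (ListSuper F)) fun i j l => ?_
    refine (NonstdPoly.mon_standard_iff E i j l).trans ?_
    simp [Finsupp.ext_iff, funext_iff]
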